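/- Let $h\in\mathbb C$, $h\ne 0$, let $I$ be a totally ordered set and let $0\ne 1$ be two elements of $I$. Let $H_I$ be the unital $\mathbb C$-algebra with generators $x_i,y_i$ ($i\in I$) and relations $x_iy_i=y_ix_i+hy_i^2$ for all $i$ and $$x_jy_i=y_ix_j+hy_iy_j,\quad y_jx_i=x_iy_j-hy_iy_j,\quad y_jy_i=y_iy_j,\quad x_jx_i=x_ix_j-hx_iy_j+hy_ix_j+h^2y_iy_j\qquad(i<j),$$ with the linear operators $E,F,H$ determined by $E x_i=0$, $E y_i=x_i$, $F x_i=y_i$, $F y_i=0$, $H x_i=x_i$, $H y_i=-y_i$ and $E(ab)=E(a)e^{-hF}(b)+e^{hF}(a)E(b)$, $F(ab)=F(a)b+aF(b)$, $H(ab)=H(a)e^{-hF}(b)+e^{hF}(a)H(b)$. An element is invariant if $E,F,H$ annihilate it. For $S\subseteq I$ let $H_S$ be the subalgebra generated by $x_i,y_i$, $i\in S$, and let $Q_S$ be its right quotient division ring. Write $x=x_0$, $y=y_0$. An $n$-form is a nonzero invariant element $f=\sum_{k=0}^n\binom nk x^{n-k}y^kA_k$ of $H_I$ with $A_k\in H_{I\setminus\{0\}}$.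 Let $\Sigma$ be a commutative field extending the field $Q_{I\setminus\{0\}}^{Inv}$ of invariant elements of $Q_{I\setminus\{0\}}$ and algebraic over it, and let $Q_I^\Sigma$ be a skew field generated by $Q_I$ and $\Sigma$ in which $\Sigma$ is central and to which the action of $E,F,H$ (and of the automorphism $e^{hF}$) extends, with the elements of $\Sigma$ being invariant (annihilated by $E,F,H$ and fixed by $e^{hF}$). Let $Q_{I\setminus\{0\}}^\Sigma$ be the division subring generated by $Q_{I\setminus\{0\}}$ and $\Sigma$. A linear form with coordinates $X,Y\in Q_{I\setminus\{0\}}^\Sigma$ is a nonzero invariant element $xY-yX-hyY$ of $Q_I^\Sigma$. For a linear form let $\Delta_{(x,y),(X,Y)}$ be the linear operator on the subalgebra generated by $H_I$ and $Q_{I\setminus\{0\}}^\Sigma$ which obeys the Leibniz rule, maps $x\mapsto X$, $y\mapsto Y$ and annihilates $Q_{I\setminus\{0\}}^\Sigma$; let $P_{(x,y),(X,Y)}=\frac1m\Delta_{(x,y),(X,Y)}$ on elements which are homogeneous of degree $m\geq 1$ in $x,y$. Let $\Delta_{01}$ be the linear operator on $H_I$ which obeys the Leibniz rule, maps $x\mapsto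 x_1$, $y\mapsto y_1$ and annihilates $x_i,y_i$ for $i\neq 0$, and let $P_{01}=\frac1m\Delta_{01}$ in degree $m\ge 1$. Let $f=\sum_{k=0}^n\binom nk x^{n-k}y^kA_k$ be an $n$-form with $A_k\in H_{I\setminus\{0,1\}}$, and suppose that $$f=C\prod_{i=1}^n(xY_i-yX_i-hyY_i),\qquad C=f_1^{1-n},\quad f_1=P_{01}^nf,$$ where the factors are pairwise commuting linear forms with coordinates $X_i,Y_i\in Q_{I\setminus\{0\}}^\Sigma$. For every linear form $xY-yX-hyY$ with coordinates in $Q_{I\setminus\{0\}}^\Sigma$ we have $Y\neq0$, and the operator $\Delta_{(x,y),(X,Y)}$ exists and is unique. Put $Z_i=X_iY_i^{-1}+\frac h2$. Then: (i) $P_{(x,y),(X_i,Y_i)}^nf=0$ for all $i\in\{1,\dots,n\}$. (ii) If $xY-yX-hyY$ is a linear form with coordinates $X,Y\in Q_{I\setminus\{0\}}^\Sigma$ and $P_{(x,y),(X,Y)}^nf=0$, then there is an $i\in\{1,\dots,n\}$ with $Z_i=XY^{-1}+\frac h2$. -/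

import Mathlib

/-! ## The algebra `H_I` -/

/-- The generators `x_i`, `y_i` (`i ∈ I`). -/
inductive PtGen (I : Type*) : Type _
  | x (i : I) : PtGen I
  | y (i : I) : PtGen I

namespace PtGen

/-- The generator `x_i` of the free algebra. -/
noncomputable def fx {I : Type*} (i : I) : FreeAlgebra ℂ (PtGen I) :=
  FreeAlgebra.ι ℂ (PtGen.x i)

/-- The generator `y_i` of the free algebra. -/
noncomputable def fy {I : Type*} (i : I) : FreeAlgebra ℂ (PtGen I) :=
  FreeAlgebra.ι ℂ (PtGen.y i)

end PtGen

open PtGen in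
/-- The defining relations of `H_I`. -/
inductive HRel (h : ℂ) (I : Type*) [LinearOrder I] :
    FreeAlgebra ℂ (PtGen I) → FreeAlgebra ℂ (PtGen I) → Prop
  | xy_self (i : I) : HRel h I (fx i * fy i) (fy i * fx i + h • (fy i * fy i))
  | xy (i j : I) (hij : i < j) : HRel h I (fx j * fy i) (fy i * fx j + h • (fy i * fy j))
  | yx (i j : I) (hij : i < j) : HRel h I (fy j * fx i) (fx i * fy j - h • (fy i * fy j))
  | yy (i j : I) (hij : i < j) : HRel h I (fy j * fy i) (fy i * fy j)
  | xx (i j : I) (hij : i < j) : HRel h I (fx j * fx i)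
      (fx i * fx j - h • (fx i * fy j) + h • (fy i * fx j) + h ^ 2 • (fy i * fy j))

/-- The algebra `H_I` with deformation parameter `h`. -/
def HAlg (h : ℂ) (I : Type*) [LinearOrder I] : Type _ := RingQuot (HRel h I)

namespace HAlg

variable {h : ℂ} {I : Type*} [LinearOrder I]

noncomputable instance : Ring (HAlg h I) := inferInstanceAs (Ring (RingQuot (HRel h I)))

noncomputable instance : Algebra ℂ (HAlg h I) :=
  inferInstanceAs (Algebra ℂ (RingQuot (HRel h I)))

/-- The quotient map from the free algebra. -/
noncomputable def mk (h : ℂ) (I : Type*) [LinearOrder I] :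
    FreeAlgebra ℂ (PtGen I) →ₐ[ℂ] HAlg h I :=
  RingQuot.mkAlgHom ℂ (HRel h I)

/-- The generator `x_i` of `H_I`. -/
noncomputable def x (i : I) : HAlg h I := mk h I (PtGen.fx i)

/-- The generator `y_i` of `H_I`. -/
noncomputable def y (i : I) : HAlg h I := mk h I (PtGen.fy i)

theorem mk_rel {a b : FreeAlgebra ℂ (PtGen I)} (r : HRel h I a b) : mk h I a = mk h I b :=
  RingQuot.mkAlgHom_rel ℂ r

theorem xy_self (i : I) :
    (x i * y i : HAlg h I) = y i * x i + h • (y i * y i) := by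
  simpa [x, y] using mk_rel (HRel.xy_self (h := h) i)

theorem xy_lt {i j : I} (hij : i < j) :
    (x j * y i : HAlg h I) = y i * x j + h • (y i * y j) := by
  simpa [x, y] using mk_rel (HRel.xy (h := h) i j hij)

theorem yx_lt {i j : I} (hij : i < j) :
    (y j * x i : HAlg h I) = x i * y j - h • (y i * y j) := by
  simpa [x, y] using mk_rel (HRel.yx (h := h) i j hij)

theorem yy_lt {i j : I} (hij : i < j) : (y j * y i : HAlg h I) = y i * y j := by
  simpa [x, y] using mk_rel (HRel.yy (h := h) i j hij)

theorem xx_lt {i j : I} (hij : i < j) :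
    (x j * x i : HAlg h I) =
      x i * x j - h • (x i * y j) + h • (y i * x j) + h ^ 2 • (y i * y j) := by
  simpa [x, y] using mk_rel (HRel.xx (h := h) i j hij)

/-- The relations do not depend on the order of `I`. -/
theorem yy (i j : I) : (y j * y i : HAlg h I) = y i * y j := by
  rcases lt_trichotomy i j with hij | rfl | hij
  · exact yy_lt hij
  · rfl
  · exact (yy_lt hij).symm

theorem xy (i j : I) : (x j * y i : HAlg h I) = y i * x j + h • (y i * y j) := by
  rcases lt_trichotomy i j with hij | rfl | hij
  · exact xy_lt hij
  · exact xy_self i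
  · rw [yx_lt hij, yy_lt hij]; abel

theorem xx (i j : I) : (x j * x i : HAlg h I) =
    x i * x j - h • (y j * x i) + h • (y i * x j) := by
  rcases lt_trichotomy i j with hij | rfl | hij
  · rw [xx_lt hij, yx_lt hij]; module
  · abel
  · rw [xx_lt hij, xy i j, yy i j]; module

/-- Algebra homomorphisms out of `H_I`. -/
noncomputable def lift {B : Type*} [Ring B] [Algebra ℂ B] (X Y : I → B)
    (hyy : ∀ i j, Y j * Y i = Y i * Y j)
    (hxy : ∀ i j, X j * Y i = Y i * X j + h • (Y i * Y j))
    (hxx : ∀ i j, X j * X i = X i * X j - h • (Y j * X i) + h • (Y i * X j)) :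
    HAlg h I →ₐ[ℂ] B :=
  RingQuot.liftAlgHom ℂ ⟨FreeAlgebra.lift ℂ (fun g => match g with
    | PtGen.x i => X i
    | PtGen.y i => Y i), by
    intro a b r
    induction r with
    | xy_self i => simpa [PtGen.fx, PtGen.fy] using hxy i i
    | xy i j _ => simpa [PtGen.fx, PtGen.fy] using hxy i j
    | yx i j _ =>
      simp only [PtGen.fx, PtGen.fy, map_sub, map_mul, map_smul, FreeAlgebra.lift_ι_apply]
      rw [hxy j i, hyy]; abel
    | yy i j _ => simpa [PtGen.fx, PtGen.fy] using hyy i j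
    | xx i j _ =>
      simp only [PtGen.fx, PtGen.fy, map_sub, map_add, map_mul, map_smul,
        FreeAlgebra.lift_ι_apply]
      rw [hxx i j, hxy j i, hyy i j]; module⟩

section
variable {B : Type*} [Ring B] [Algebra ℂ B] (X Y : I → B)
    (hyy : ∀ i j, Y j * Y i = Y i * Y j)
    (hxy : ∀ i j, X j * Y i = Y i * X j + h • (Y i * Y j))
    (hxx : ∀ i j, X j * X i = X i * X j - h • (Y j * X i) + h • (Y i * X j))

@[simp] theorem lift_x (i : I) : lift (h := h) X Y hyy hxy hxx (x i) = X i := by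
  unfold lift x mk PtGen.fx
  erw [RingQuot.liftAlgHom_mkAlgHom_apply]
  simp

@[simp] theorem lift_y (i : I) : lift (h := h) X Y hyy hxy hxx (y i) = Y i := by
  unfold lift y mk PtGen.fy
  erw [RingQuot.liftAlgHom_mkAlgHom_apply]
  simp

end

theorem algHom_ext {B : Type*} [Ring B] [Algebra ℂ B] {f g : HAlg h I →ₐ[ℂ] B}
    (hx : ∀ i, f (x i) = g (x i)) (hy : ∀ i, f (y i) = g (y i)) : f = g := by
  apply RingQuot.ringQuot_ext' (S := ℂ) (s := HRel h I)
  apply FreeAlgebra.hom_ext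
  funext a
  cases a with
  | x i => exact hx i
  | y i => exact hy i

/-! ## The action of `U_h(sl(2))` on `H_I` -/

/-- The operator `e^{tF}`: the exponential of the locally nilpotent derivation `t F`, where
`F x_i = y_i` and `F y_i = 0`, is the algebra homomorphism `x_i ↦ x_i + t y_i`, `y_i ↦ y_i`. -/
noncomputable def expF (t : ℂ) : HAlg h I →ₐ[ℂ] HAlg h I :=
  lift (fun i => x i + t • y i) y yy
    (by
      intro i j
      simp only [add_mul, smul_mul_assoc, mul_add, mul_smul_comm, xy i j, yy i j]
      module)
    (by
      intro i j
      simp only [add_mul, mul_add, smul_mul_assoc, mul_smul_comm, xy i j, xx i j, yy i j, xy j i]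
      module)

/-- The linear map `d` on `H_I` with `d x_i = u i`, `d y_i = v i` and
`d (a b) = d a · β b + α a · d b`: the upper right entry of the algebra homomorphism
`a ↦ !![α a, d a; 0, β a]`. The last three arguments say that `d` respects the relations. -/
noncomputable def twistedHom (α β : HAlg h I →ₐ[ℂ] HAlg h I) (u v : I → HAlg h I)
    (hyy : ∀ i j, α (y j) * v i + v j * β (y i) = α (y i) * v j + v i * β (y j))
    (hxy : ∀ i j, α (x j) * v i + u j * β (y i) =
      α (y i) * u j + v i * β (x j) + h • (α (y i) * v j + v i * β (y j)))
    (hxx : ∀ i j, α (x j) * u i + u j * β (x i) = α (x i) * u j + u i * β (x j)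
      - h • (α (y j) * u i + v j * β (x i)) + h • (α (y i) * u j + v i * β (x j))) :
    HAlg h I →ₐ[ℂ] Matrix (Fin 2) (Fin 2) (HAlg h I) :=
  lift (fun i => !![α (x i), u i; 0, β (x i)]) (fun i => !![α (y i), v i; 0, β (y i)])
    (by
      intro i j
      simp only [Matrix.mul_fin_two, mul_zero, zero_mul, add_zero, zero_add, ← map_mul, yy i j,
        hyy i j])
    (by
      intro i j
      simp only [Matrix.mul_fin_two, mul_zero, zero_mul, add_zero, zero_add, ← map_mul, xy i j,
        hxy i j]
      ext a b; fin_cases a <;> fin_cases b <;> simp)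
    (by
      intro i j
      simp only [Matrix.mul_fin_two, mul_zero, zero_mul, add_zero, zero_add, ← map_mul, xx i j,
        hxx i j]
      ext a b; fin_cases a <;> fin_cases b <;> simp)

theorem induction {P : HAlg h I → Prop} (hc : ∀ c : ℂ, P (algebraMap ℂ _ c))
    (hx : ∀ i, P (x i)) (hy : ∀ i, P (y i)) (hadd : ∀ a b, P a → P b → P (a + b))
    (hmul : ∀ a b, P a → P b → P (a * b)) (a : HAlg h I) : P a := by
  obtain ⟨a, rfl⟩ : ∃ b, mk h I b = a := RingQuot.mkAlgHom_surjective ℂ (HRel h I) a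
  induction a using FreeAlgebra.induction with
  | grade0 c => simpa using hc c
  | grade1 g =>
    cases g with
    | x i => exact hx i
    | y i => exact hy i
  | mul a b ha hb => simpa using hmul _ _ ha hb
  | add a b ha hb => simpa using hadd _ _ ha hb

theorem twistedHom_apply (α β : HAlg h I →ₐ[ℂ] HAlg h I) (u v : I → HAlg h I) (hyy hxy hxx)
    (a : HAlg h I) :
    twistedHom α β u v hyy hxy hxx a 0 0 = α a ∧ twistedHom α β u v hyy hxy hxx a 1 0 = 0 ∧
      twistedHom α β u v hyy hxy hxx a 1 1 = β a := by
  induction a using HAlg.induction with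
  | hc c => simp [Matrix.algebraMap_matrix_apply]
  | hx i => simp [twistedHom]
  | hy i => simp [twistedHom]
  | hadd a b ha hb => simp [ha, hb]
  | hmul a b ha hb => simp [Matrix.mul_apply, ha, hb]

/-- The upper right entry of a matrix-valued linear map. -/
noncomputable def upperRight (φ : HAlg h I →ₐ[ℂ] Matrix (Fin 2) (Fin 2) (HAlg h I)) :
    HAlg h I →ₗ[ℂ] HAlg h I :=
  (Matrix.entryLinearMap ℂ (HAlg h I) 0 1) ∘ₗ φ.toLinearMap


theorem upperRight_mul (α β : HAlg h I →ₐ[ℂ] HAlg h I) (u v : I → HAlg h I) (hyy hxy hxx)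
    (a b : HAlg h I) :
    upperRight (twistedHom α β u v hyy hxy hxx) (a * b) =
      upperRight (twistedHom α β u v hyy hxy hxx) a * β b +
        α a * upperRight (twistedHom α β u v hyy hxy hxx) b := by
  have ha := twistedHom_apply α β u v hyy hxy hxx a
  have hb := twistedHom_apply α β u v hyy hxy hxx b
  simp [upperRight, Matrix.mul_apply, ha, hb, add_comm]

theorem upperRight_x (α β : HAlg h I →ₐ[ℂ] HAlg h I) (u v : I → HAlg h I) (hyy hxy hxx) (i : I) :
    upperRight (twistedHom α β u v hyy hxy hxx) (x i) = u i := by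
  simp [upperRight, twistedHom]

theorem upperRight_y (α β : HAlg h I →ₐ[ℂ] HAlg h I) (u v : I → HAlg h I) (hyy hxy hxx) (i : I) :
    upperRight (twistedHom α β u v hyy hxy hxx) (y i) = v i := by
  simp [upperRight, twistedHom]

@[simp] theorem expF_x (t : ℂ) (i : I) : expF t (x i : HAlg h I) = x i + t • y i := lift_x ..

@[simp] theorem expF_y (t : ℂ) (i : I) : expF t (y i : HAlg h I) = y i := lift_y ..

/-- The action of `E` : `E x_i = 0`, `E y_i = x_i`,
`E (a b) = E a · e^{-hF} b + e^{hF} a · E b`. -/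
noncomputable def opE : HAlg h I →ₗ[ℂ] HAlg h I :=
  upperRight (twistedHom (expF h) (expF (-h)) (fun _ => 0) x
    (by
      intro i j
      simp only [expF_x, expF_y, xy i j, yy i j, xy j i]
      module)
    (by
      intro i j
      simp only [expF_x, expF_y, mul_add, add_mul, smul_mul_assoc, mul_smul_comm, neg_smul,
        mul_neg, zero_mul, mul_zero, xy i j, yy i j, xx i j, xy j i]
      module)
    (by
      intro i j
      simp only [expF_x, expF_y, mul_add, add_mul, smul_mul_assoc, mul_smul_comm, neg_smul,
        mul_neg, zero_mul, mul_zero, xy i j, yy i j, xx i j, xy j i]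
      module))

/-- The action of `F` : `F x_i = y_i`, `F y_i = 0`, `F (a b) = F a · b + a · F b`. -/
noncomputable def opF : HAlg h I →ₗ[ℂ] HAlg h I :=
  upperRight (twistedHom (AlgHom.id ℂ _) (AlgHom.id ℂ _) y (fun _ => 0)
    (by intro i j; simp)
    (by intro i j; simp [yy i j])
    (by
      intro i j
      simp only [AlgHom.coe_id, id_eq, zero_mul, add_zero, xy i j, xy j i, yy i j]
      module))

/-- The action of `H` : `H x_i = x_i`, `H y_i = - y_i`,
`H (a b) = H a · e^{-hF} b + e^{hF} a · H b`. -/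
noncomputable def opH : HAlg h I →ₗ[ℂ] HAlg h I :=
  upperRight (twistedHom (expF h) (expF (-h)) x (fun i => - y i)
    (by
      intro i j
      simp only [expF_y, yy i j, mul_neg, neg_mul])
    (by
      intro i j
      simp only [expF_x, expF_y, mul_add, add_mul, smul_mul_assoc, mul_smul_comm, neg_smul,
        mul_neg, neg_mul, xy i j, yy i j]
      module)
    (by
      intro i j
      simp only [expF_x, expF_y, mul_add, add_mul, smul_mul_assoc, mul_smul_comm, neg_smul,
        mul_neg, neg_mul, xy i j, yy i j, xx i j, xy j i]
      module))

/-- The polarization operator `Δ_{kl}` : `x_k ↦ x_l`, `y_k ↦ y_l`, `x_i, y_i ↦ 0` for `i ≠ k`,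
`Δ (a b) = Δ a · b + a · Δ b`. -/
noncomputable def opPol (k l : I) : HAlg h I →ₗ[ℂ] HAlg h I :=
  upperRight (twistedHom (AlgHom.id ℂ _) (AlgHom.id ℂ _)
    (fun i => if i = k then x l else 0) (fun i => if i = k then y l else 0)
    (by
      intro i j
      by_cases hi : i = k <;> by_cases hj : j = k <;> simp [hi, hj, yy k l, yy l j, yy i l])
    (by
      intro i j
      by_cases hi : i = k <;> by_cases hj : j = k <;>
        simp only [AlgHom.coe_id, id_eq, hi, hj, if_true, if_false, xy k l, xy l k, xy l j, xy i l,
          yy k l, mul_zero, zero_mul, smul_zero, add_zero, zero_add] <;> module)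
    (by
      intro i j
      by_cases hi : i = k <;> by_cases hj : j = k <;>
        simp only [AlgHom.coe_id, id_eq, hi, hj, if_true, if_false, xx l j, xx i l,
          mul_zero, zero_mul, smul_zero, add_zero, zero_add, sub_zero, zero_sub] <;>
          first | done | module))

theorem opE_mul (a b : HAlg h I) :
    opE (a * b) = opE a * expF (-h) b + expF h a * opE b := upperRight_mul ..

theorem opF_mul (a b : HAlg h I) : opF (a * b) = opF a * b + a * opF b := upperRight_mul ..

theorem opH_mul (a b : HAlg h I) :
    opH (a * b) = opH a * expF (-h) b + expF h a * opH b := upperRight_mul ..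

theorem opPol_mul (k l : I) (a b : HAlg h I) :
    opPol k l (a * b) = opPol k l a * b + a * opPol k l b := upperRight_mul ..

@[simp] theorem opE_x (i : I) : opE (x i : HAlg h I) = 0 := upperRight_x ..
@[simp] theorem opE_y (i : I) : opE (y i : HAlg h I) = x i := upperRight_y ..
@[simp] theorem opF_x (i : I) : opF (x i : HAlg h I) = y i := upperRight_x ..
@[simp] theorem opF_y (i : I) : opF (y i : HAlg h I) = 0 := upperRight_y ..
@[simp] theorem opH_x (i : I) : opH (x i : HAlg h I) = x i := upperRight_x ..
@[simp] theorem opH_y (i : I) : opH (y i : HAlg h I) = - y i := upperRight_y ..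

/-- `v ∈ H_I` is an invariant element. -/
def IsInvariant (v : HAlg h I) : Prop := opE v = 0 ∧ opF v = 0 ∧ opH v = 0

/-- The subalgebra `H_S` of `H_I` generated by the `x_i`, `y_i` with `i ∈ S`. -/
noncomputable def sub (h : ℂ) {I : Type*} [LinearOrder I] (S : Set I) : Subalgebra ℂ (HAlg h I) :=
  Algebra.adjoin ℂ (x '' S ∪ y '' S)

/-- `∑_{k=0}^n (n choose k) x^{n-k} y^k A_k` with `x = x_o`, `y = y_o`. -/
noncomputable def formSum (o : I) (n : ℕ) (A : ℕ → HAlg h I) : HAlg h I :=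
  ∑ k ∈ Finset.range (n + 1), (n.choose k : ℂ) • (x o ^ (n - k) * y o ^ k * A k)

/-- `f` is an `n`-form in the variables `x_o`, `y_o`. -/
def IsForm (o : I) (n : ℕ) (f : HAlg h I) : Prop :=
  f ≠ 0 ∧ IsInvariant f ∧ ∃ A : ℕ → HAlg h I, (∀ k ≤ n, A k ∈ sub h {o}ᶜ) ∧ f = formSum o n A

end HAlg

/-! ## Polarization -/

/-- `P^n a`, where `a` is homogeneous of degree `n` and the polarization `P` is `(1/m) Δ` on
homogeneous elements of degree `m` (and `Δ` lowers the degree by one). -/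
noncomputable def polarPow {M : Type*} [AddCommGroup M] [Module ℂ M] (Δ : M →ₗ[ℂ] M) :
    ℕ → M → M
  | 0, a => a
  | n + 1, a => polarPow Δ n (((n : ℂ) + 1)⁻¹ • Δ a)

/-! ## The skew field `Q_I^Σ` -/

open HAlg

/-- A skew field `D = Q_I^Σ`. The algebra `H_I` is embedded into `D` by `ι`; the right quotient
division ring `Q_S` of a subalgebra `H_S` is the division subring of `D` generated by `ι(H_S)`.
`Σ` is a central subfield of `D`, an algebraic extension of the field of the invariant elements
of `Q_{I \ {o}}`, and `D` is generated by `ι(H_I)` and `Σ`. The action of `U_h(sl(2))` on `H_I`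
extends to `D`, and the elements of `Σ` are invariant. (These conditions determine the operators
`E`, `F`, `H`, `e^{hF}` on `D`.) -/
structure SkewExt {h : ℂ} {I : Type*} [LinearOrder I] (o : I)
    (D : Type*) [DivisionRing D] [Algebra ℂ D] where
  /-- the embedding of `H_I` -/
  ι : HAlg h I →ₐ[ℂ] D
  ι_injective : Function.Injective ι
  /-- the operator `e^{hF}` -/
  K : D ≃ₐ[ℂ] D
  /-- the action of `E` -/
  E : D →ₗ[ℂ] D
  /-- the action of `F` -/
  F : D →ₗ[ℂ] D
  /-- the action of `H` -/
  H : D →ₗ[ℂ] D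
  K_ι : ∀ a, K (ι a) = ι (expF h a)
  E_ι : ∀ a, E (ι a) = ι (opE a)
  F_ι : ∀ a, F (ι a) = ι (opF a)
  H_ι : ∀ a, H (ι a) = ι (opH a)
  E_mul : ∀ a b, E (a * b) = E a * K.symm b + K a * E b
  F_mul : ∀ a b, F (a * b) = F a * b + a * F b
  H_mul : ∀ a b, H (a * b) = H a * K.symm b + K a * H b
  /-- the commutative field `Σ` -/
  Sig : Subfield D
  Sig_central : ∀ s ∈ Sig, ∀ d : D, s * d = d * s
  Sig_invariant : ∀ s ∈ Sig, K s = s ∧ E s = 0 ∧ F s = 0 ∧ H s = 0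
  Sig_extends : ∀ v ∈ Subfield.closure (ι '' (HAlg.sub h {o}ᶜ : Set (HAlg h I))),
    E v = 0 → F v = 0 → H v = 0 → v ∈ Sig
  Sig_algebraic : ∀ s ∈ Sig, ∃ p : Polynomial D, p ≠ 0 ∧ p.eval s = 0 ∧
    ∀ k, p.coeff k ∈ Subfield.closure (ι '' (HAlg.sub h {o}ᶜ : Set (HAlg h I))) ∧
      E (p.coeff k) = 0 ∧ F (p.coeff k) = 0 ∧ H (p.coeff k) = 0
  generated : Subfield.closure (Set.range ι ∪ Sig) = ⊤

namespace SkewExt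

variable {h : ℂ} {I : Type*} [LinearOrder I] {o : I} {D : Type*} [DivisionRing D] [Algebra ℂ D]
  (Q : SkewExt (h := h) o D)

/-- The skew field `Q_{I \ {o}}^Σ`. -/
def coeffs : Subfield D :=
  Subfield.closure (Q.ι '' (HAlg.sub h {o}ᶜ : Set (HAlg h I)) ∪ Q.Sig)

/-- The element `x Y - y X - h y Y` of `D`, where `x = x_o`, `y = y_o`. -/
noncomputable def lin (X Y : D) : D :=
  Q.ι (x o) * Y - Q.ι (y o) * X - h • (Q.ι (y o) * Y)

/-- `x Y - y X - h y Y` is a linear form with coordinates `X`, `Y` in `Q_{I \ {o}}^Σ`. -/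
def IsLinearForm (X Y : D) : Prop :=
  X ∈ Q.coeffs ∧ Y ∈ Q.coeffs ∧ Q.lin X Y ≠ 0 ∧
    Q.E (Q.lin X Y) = 0 ∧ Q.F (Q.lin X Y) = 0 ∧ Q.H (Q.lin X Y) = 0

/-- The subalgebra of `D` generated by `H_I` and `Q_{I \ {o}}^Σ`, that is, the polynomials in
`x`, `y` with coefficients in `Q_{I \ {o}}^Σ`. -/
noncomputable def polys : Subalgebra ℂ D := Algebra.adjoin ℂ (Set.range Q.ι ∪ Q.coeffs)

/-- An element of `H_I` as an element of `Q.polys`. -/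
noncomputable def toPolys (a : HAlg h I) : Q.polys :=
  ⟨Q.ι a, Algebra.subset_adjoin (Or.inl ⟨a, rfl⟩)⟩

/-- `Δ` is the operator `Δ_{(x,y),(X,Y)}`: it obeys the Leibniz rule, maps `x` to `X` and `y`
to `Y`, and vanishes on elements which do not contain `x`, `y`. -/
def IsPolarization (X Y : D) (Δ : Q.polys →ₗ[ℂ] Q.polys) : Prop :=
  (∀ a b, Δ (a * b) = Δ a * b + a * Δ b) ∧
  (Δ (Q.toPolys (x o)) : D) = X ∧ (Δ (Q.toPolys (y o)) : D) = Y ∧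
  ∀ a : Q.polys, (a : D) ∈ Q.coeffs → Δ a = 0

/-- `f = C ∏_{i=1}^n (x Y_i - y X_i - h y Y_i)` is a decomposition of `f` into commuting
(invariant) linear forms with coordinates in `Q_{I \ {o}}^Σ`, where `C = f₁^{1-n}` and
`f₁ = P_{oe}^n f` is the `n`-th polar of `f`. -/
def IsDecomposition (e : I) (n : ℕ) (f : HAlg h I) (X Y : Fin n → D) : Prop :=
  (∀ i, Q.IsLinearForm (X i) (Y i)) ∧
  (∀ i j, Commute (Q.lin (X i) (Y i)) (Q.lin (X j) (Y j))) ∧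
  Q.ι f = Q.ι (polarPow (opPol o e) n f) ^ (1 - (n : ℤ)) *
    (List.ofFn fun i => Q.lin (X i) (Y i)).prod

end SkewExt

/-! ## Skew polynomials inside a division ring -/

/-! The heart of the matter is that the coordinates of a linear form behave like one more pair of
generators. In `D` every generator satisfies y_j a = K⁻¹(a) y_j and x_j a = K(a) x_j - h y_j
Hsym(a), where K = e^{hF} and Hsym = (HK + KH)/2. Call a pair (X, Y) with these relations against
the coefficients a point. For two points the ratio Y Y'⁻¹ and the bracket X Y' - Y X' - h Y Y'
commute with the coefficients, and for two generators they are central in `D`.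

Fix e ≠ o. Then x_o and y_o are combinations of u = y_o y_e⁻¹ and of the bracket c of (x_o, y_o)
with (x_e, y_e). A representation by shift operators shows that all such ratios and brackets are
algebraically independent. The coefficients lie in a division ring generated by x_e, y_e and a field
of constants algebraic over the ratios and brackets with index different from o. Skew polynomial
arguments show that its central elements are constants; the same arguments put the invariants of the
division ring generated by the generators with index ≠ o, and with them Σ, among the constants.
Hence the monomials in u and c are linearly independent over the coefficients
(`eq_zero_of_sum_monomials`), and `Q.polys` is a polynomial ring over them in two central variables.

Three consequences follow. Applying E, F, H to a linear form and comparing coefficients of x_o and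
y_o shows that (X, Y) is a point with Y ≠ 0 (`IsLinearForm.pointOn`). The polarization operator
exists, because a derivation of a polynomial ring may be prescribed on the variables
(`exists_polarization`). And since C is a coefficient, P^n f is C times the product of the brackets
of (X, Y) with the (X_i, Y_i) (`polarPow_decomposition`).

The bracket of a linear form with itself vanishes, which is (i). In a division ring a vanishing
product has a vanishing factor, and two linear forms with zero bracket have the same X Y⁻¹, which is
(ii). -/

section SkewPolynomials

variable {D : Type*} [DivisionRing D]

/-- The elements `∑_{k<n} z^k m_k` with `m_k ∈ M`. -/
def degLT (M : Subfield D) (z : D) : ℕ → AddSubgroup D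
  | 0 => ⊥
  | n + 1 => degLT M z n ⊔ M.toSubring.toAddSubgroup.map (AddMonoidHom.mulLeft (z ^ n))

variable {M : Subfield D} {z : D}

theorem mem_degLT_zero {a : D} : a ∈ degLT M z 0 ↔ a = 0 := by
  simp [degLT]

theorem mem_degLT_succ {a : D} {n : ℕ} :
    a ∈ degLT M z (n + 1) ↔ ∃ m ∈ M, a - z ^ n * m ∈ degLT M z n := by
  simp only [degLT, AddSubgroup.mem_sup, AddSubgroup.mem_map]
  constructor
  · rintro ⟨b, hb, _, ⟨m, hm, rfl⟩, rfl⟩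
    exact ⟨m, hm, by simpa using hb⟩
  · rintro ⟨m, hm, hb⟩
    exact ⟨_, hb, _, ⟨m, hm, rfl⟩, by simp⟩

theorem degLT_succ_le (n : ℕ) : degLT M z n ≤ degLT M z (n + 1) := le_sup_left

theorem degLT_mono : Monotone (degLT M z) := monotone_nat_of_le_succ degLT_succ_le

theorem pow_mul_mem_degLT {m : D} (hm : m ∈ M) (n : ℕ) : z ^ n * m ∈ degLT M z (n + 1) :=
  mem_degLT_succ.2 ⟨m, hm, by simp [zero_mem]⟩

theorem mem_degLT_one {a : D} : a ∈ degLT M z 1 ↔ a ∈ M := by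
  rw [mem_degLT_succ]
  constructor
  · rintro ⟨m, hm, h⟩
    rw [mem_degLT_zero, pow_zero, one_mul, sub_eq_zero] at h
    exact h ▸ hm
  · exact fun h => ⟨a, h, by simp [zero_mem]⟩

theorem mul_coeff_mem_degLT {n : ℕ} {a m : D} (ha : a ∈ degLT M z n) (hm : m ∈ M) :
    a * m ∈ degLT M z n := by
  induction n generalizing a with
  | zero => rw [mem_degLT_zero] at ha ⊢; simp [ha]
  | succ n ih =>
    obtain ⟨m', hm', h⟩ := mem_degLT_succ.1 ha
    refine mem_degLT_succ.2 ⟨m' * m, mul_mem hm' hm, ?_⟩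
    simpa [sub_mul, mul_assoc] using ih h

/-- Moving `z` to the left of a coefficient costs only the commutator `z * m - m * z`, which is
again a coefficient. -/
theorem mul_gen_mem_degLT (hM : ∀ m ∈ M, z * m - m * z ∈ M) {n : ℕ} {a : D}
    (ha : a ∈ degLT M z n) : a * z ∈ degLT M z (n + 1) := by
  induction n generalizing a with
  | zero => rw [mem_degLT_zero] at ha; simp [ha, zero_mem]
  | succ n ih =>
    obtain ⟨m, hm, h⟩ := mem_degLT_succ.1 ha
    have h1 : a * z = (a - z ^ n * m) * z + z ^ (n + 1) * m - z ^ n * (z * m - m * z) := by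
      rw [pow_succ]; noncomm_ring
    rw [h1]
    exact sub_mem (add_mem (degLT_succ_le _ (ih h)) (pow_mul_mem_degLT hm _))
      (degLT_succ_le _ (pow_mul_mem_degLT (hM m hm) n))

theorem mul_pow_mem_degLT (hM : ∀ m ∈ M, z * m - m * z ∈ M) {n : ℕ} (k : ℕ) {a : D}
    (ha : a ∈ degLT M z n) : a * z ^ k ∈ degLT M z (n + k) := by
  induction k with
  | zero => simpa using ha
  | succ k ih => rw [pow_succ, ← mul_assoc]; exact mul_gen_mem_degLT hM ih

theorem exists_mul_mem_degLT (hM : ∀ m ∈ M, z * m - m * z ∈ M) {n k : ℕ} {a b : D}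
    (ha : a ∈ degLT M z n) (hb : b ∈ degLT M z k) : ∃ N, a * b ∈ degLT M z N := by
  induction k generalizing b with
  | zero => exact ⟨0, by rw [mem_degLT_zero] at hb ⊢; simp [hb]⟩
  | succ k ih =>
    obtain ⟨m, hm, h⟩ := mem_degLT_succ.1 hb
    obtain ⟨N, hN⟩ := ih h
    have h1 : a * b = a * (b - z ^ k * m) + a * z ^ k * m := by noncomm_ring
    rw [h1]
    exact ⟨max N (n + k), add_mem (degLT_mono (le_max_left _ _) hN)
      (degLT_mono (le_max_right _ _) (mul_coeff_mem_degLT (mul_pow_mem_degLT hM k ha) hm))⟩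

/-- The ring of skew polynomials in `z` with coefficients in `M`. -/
def skewPolys (M : Subfield D) (z : D) : Subring D := Subring.closure (insert z (M : Set D))

theorem coeff_mem_skewPolys {m : D} (hm : m ∈ M) : m ∈ skewPolys M z :=
  Subring.subset_closure (Or.inr hm)

theorem gen_mem_skewPolys : z ∈ skewPolys M z :=
  Subring.subset_closure (Or.inl rfl)

theorem degLT_le_skewPolys {n : ℕ} {a : D} (ha : a ∈ degLT M z n) : a ∈ skewPolys M z := by
  induction n generalizing a with
  | zero => rw [mem_degLT_zero] at ha; exact ha ▸ zero_mem _
  | succ n ih =>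
    obtain ⟨m, hm, h⟩ := mem_degLT_succ.1 ha
    have := add_mem (ih h) (mul_mem (pow_mem gen_mem_skewPolys n) (coeff_mem_skewPolys hm))
    simpa using this

theorem mem_skewPolys_iff (hM : ∀ m ∈ M, z * m - m * z ∈ M) {a : D} :
    a ∈ skewPolys M z ↔ ∃ n, a ∈ degLT M z n := by
  refine ⟨fun ha => ?_, fun ⟨n, h⟩ => degLT_le_skewPolys h⟩
  induction ha using Subring.closure_induction with
  | mem a ha =>
    rcases ha with rfl | ha
    · exact ⟨2, by simpa using pow_mul_mem_degLT (z := a) (one_mem M) 1⟩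
    · exact ⟨1, mem_degLT_one.2 ha⟩
  | zero => exact ⟨0, zero_mem _⟩
  | one => exact ⟨1, mem_degLT_one.2 (one_mem _)⟩
  | add a b _ _ ha hb =>
    obtain ⟨n, hn⟩ := ha
    obtain ⟨k, hk⟩ := hb
    exact ⟨max n k, add_mem (degLT_mono (le_max_left _ _) hn) (degLT_mono (le_max_right _ _) hk)⟩
  | neg a _ ha => exact ha.imp fun n hn => neg_mem hn
  | mul a b _ _ ha hb =>
    obtain ⟨n, hn⟩ := ha
    obtain ⟨k, hk⟩ := hb
    exact exists_mul_mem_degLT hM hn hk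

/-- Division with remainder by a monic skew polynomial. -/
theorem exists_sub_mul_mem_degLT (hM : ∀ m ∈ M, z * m - m * z ∈ M) {n : ℕ} {b : D}
    (hb : b - z ^ n ∈ degLT M z n) {p : ℕ} {a : D} (ha : a ∈ degLT M z p) :
    ∃ c ∈ skewPolys M z, a - b * c ∈ degLT M z n := by
  induction p generalizing a with
  | zero => exact ⟨0, zero_mem _, by rw [mem_degLT_zero] at ha; simp [ha, zero_mem]⟩
  | succ p ih =>
    by_cases hp : p + 1 ≤ n
    · exact ⟨0, zero_mem _, by simpa using degLT_mono hp ha⟩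
    obtain ⟨k, rfl⟩ := Nat.exists_eq_add_of_le (show n ≤ p by omega)
    obtain ⟨m, hm, h⟩ := mem_degLT_succ.1 ha
    have h1 : a - b * (z ^ k * m) ∈ degLT M z (n + k) := by
      have h2 := mul_coeff_mem_degLT (mul_pow_mem_degLT hM k hb) hm
      have h3 : a - b * (z ^ k * m) = (a - z ^ (n + k) * m) - (b - z ^ n) * z ^ k * m := by
        rw [pow_add]; noncomm_ring
      rw [h3]
      exact sub_mem h h2
    obtain ⟨c, hc, h⟩ := ih h1
    refine ⟨z ^ k * m + c, add_mem (mul_mem (pow_mem gen_mem_skewPolys k)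
      (coeff_mem_skewPolys hm)) hc, ?_⟩
    rwa [mul_add, ← sub_sub]

/-- Leading coefficients are invertible. -/
theorem exists_monic_of_mem_degLT {n : ℕ} {b : D} (hb : b ∈ degLT M z (n + 1)) :
    b ∈ degLT M z n ∨ ∃ m ∈ M, m ≠ 0 ∧ b * m⁻¹ - z ^ n ∈ degLT M z n := by
  obtain ⟨m, hm, h⟩ := mem_degLT_succ.1 hb
  by_cases h0 : m = 0
  · left; simpa [h0] using h
  · right
    refine ⟨m, hm, h0, ?_⟩
    have := mul_coeff_mem_degLT h (inv_mem hm)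
    rwa [sub_mul, mul_assoc, mul_inv_cancel₀ h0, mul_one] at this

/-- The Ore condition. -/
theorem exists_common_multiple (hM : ∀ m ∈ M, z * m - m * z ∈ M) {n : ℕ} {a b : D}
    (ha : a ∈ skewPolys M z) (hb : b ∈ degLT M z n) (hb0 : b ≠ 0) :
    ∃ u ∈ skewPolys M z, u ≠ 0 ∧ ∃ v ∈ skewPolys M z, a * u = b * v := by
  induction n generalizing a b with
  | zero => exact absurd (mem_degLT_zero.1 hb) hb0
  | succ n ih =>
    obtain h | ⟨m, hm, h0, h⟩ := exists_monic_of_mem_degLT hb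
    · exact ih ha h hb0
    obtain ⟨p, hp⟩ := (mem_skewPolys_iff hM).1 ha
    obtain ⟨c, hc, hs⟩ := exists_sub_mul_mem_degLT hM h hp
    have hmc := mul_mem (coeff_mem_skewPolys (z := z) (inv_mem hm)) hc
    by_cases hs0 : a - b * m⁻¹ * c = 0
    · exact ⟨1, one_mem _, one_ne_zero, m⁻¹ * c, hmc, by
        rw [mul_one, ← mul_assoc]; exact sub_eq_zero.1 hs0⟩
    -- Euclidean algorithm with the roles exchanged: the remainder r = a - b m⁻¹ c has smaller
    -- degree, and b u = r v rearranges to a v = b (m⁻¹ c v + u).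
    obtain ⟨u, hu, hu0, v, hv, huv⟩ := ih (degLT_le_skewPolys hb) hs hs0
    refine ⟨v, hv, ?_, m⁻¹ * c * v + u, add_mem (mul_mem hmc hv) hu, ?_⟩
    · rintro rfl
      rw [mul_zero] at huv
      exact mul_ne_zero hb0 hu0 huv
    · rw [mul_add, huv]; noncomm_ring

/-- Elements of the division ring generated by skew polynomials are fractions. -/
theorem exists_fraction (hM : ∀ m ∈ M, z * m - m * z ∈ M) {S : Set D}
    (hS : S ⊆ skewPolys M z) {q : D} (hq : q ∈ Subfield.closure S) :
    ∃ b ∈ skewPolys M z, b ≠ 0 ∧ q * b ∈ skewPolys M z := by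
  have ore : ∀ {a b : D}, a ∈ skewPolys M z → b ∈ skewPolys M z → b ≠ 0 →
      ∃ u ∈ skewPolys M z, u ≠ 0 ∧ ∃ v ∈ skewPolys M z, a * u = b * v := by
    intro a b ha hb hb0
    obtain ⟨n, hn⟩ := (mem_skewPolys_iff hM).1 hb
    exact exists_common_multiple hM ha hn hb0
  induction hq using Subfield.closure_induction with
  | mem a ha => exact ⟨1, one_mem _, one_ne_zero, by simpa using hS ha⟩
  | one => exact ⟨1, one_mem _, one_ne_zero, by simp [one_mem]⟩
  | add p q _ _ hp hq =>
    obtain ⟨b, hb, hb0, ha⟩ := hp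
    obtain ⟨d, hd, hd0, hc⟩ := hq
    obtain ⟨u, hu, hu0, v, hv, h⟩ := ore hb hd hd0
    refine ⟨b * u, mul_mem hb hu, mul_ne_zero hb0 hu0, ?_⟩
    have h1 : (p + q) * (b * u) = p * b * u + q * d * v := by
      rw [add_mul, mul_assoc p, mul_assoc q, h]
    rw [h1]
    exact add_mem (mul_mem ha hu) (mul_mem hc hv)
  | neg p _ hp =>
    obtain ⟨b, hb, hb0, ha⟩ := hp
    exact ⟨b, hb, hb0, by rw [neg_mul]; exact neg_mem ha⟩
  | inv p _ hp =>
    obtain ⟨b, hb, hb0, ha⟩ := hp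
    by_cases h0 : p = 0
    · exact ⟨1, one_mem _, one_ne_zero, by simp [h0, zero_mem]⟩
    · exact ⟨p * b, ha, mul_ne_zero h0 hb0, by rwa [inv_mul_cancel_left₀ h0]⟩
  | mul p q _ _ hp hq =>
    obtain ⟨b, hb, hb0, ha⟩ := hp
    obtain ⟨d, hd, hd0, hc⟩ := hq
    obtain ⟨u, hu, hu0, v, hv, h⟩ := ore hc hb hb0
    refine ⟨d * u, mul_mem hd hu, mul_ne_zero hd0 hu0, ?_⟩
    have h1 : p * q * (d * u) = p * b * v := by
      rw [mul_assoc p b, ← h]; noncomm_ring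
    rw [h1]
    exact mul_mem ha hv

end SkewPolynomials

/-! ### Centralizers in division rings of skew fractions -/

section Centralizers

variable {D : Type*} [DivisionRing D] [Algebra ℂ D] {M : Subfield D} {z : D}

/-- Conjugation by `g` sends `z` to z - η, so these are the two leading terms of (z - η)^{n+1}. -/
theorem conj_pow_sub_mem (hM : ∀ m ∈ M, z * m - m * z ∈ M) (hc : ∀ c : ℂ, algebraMap ℂ D c ∈ M)
    {g : D} {η : ℂ} (hg0 : g ≠ 0) (hgz : g * z = (z - algebraMap ℂ D η) * g) (n : ℕ) :
    g * z ^ (n + 1) * g⁻¹ - z ^ (n + 1) + z ^ n * algebraMap ℂ D ((n + 1) * η)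
      ∈ degLT M z n := by
  induction n with
  | zero =>
    rw [mem_degLT_zero]
    simp [hgz, hg0]
  | succ n ih =>
    have h1 : g * z ^ (n + 1 + 1) * g⁻¹ = (g * z ^ (n + 1) * g⁻¹) * (z - algebraMap ℂ D η) := by
      have : g * z * g⁻¹ = z - algebraMap ℂ D η := by rw [hgz, mul_inv_cancel_right₀ hg0]
      rw [← this, pow_succ z (n + 1)]
      simp [mul_assoc, hg0]
    have hcom : ∀ c : ℂ, ∀ a : D, algebraMap ℂ D c * a = a * algebraMap ℂ D c :=
      fun c a => Algebra.commutes c a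
    have e1 : algebraMap ℂ D (((n + 1 : ℕ) + 1) * η)
        = algebraMap ℂ D ((n + 1) * η) + algebraMap ℂ D η := by
      rw [← map_add]; congr 1; push_cast; ring
    have e2 : z ^ n * (algebraMap ℂ D ((n + 1) * η) * algebraMap ℂ D η) ∈ degLT M z (n + 1) :=
      pow_mul_mem_degLT (mul_mem (hc _) (hc _)) n
    rw [h1, e1]
    have hκ := hcom ((n + 1) * η) z
    have hcε := hc η
    generalize algebraMap ℂ D ((n + 1) * η) = κ at *
    generalize algebraMap ℂ D η = ε at *
    have h3 : g * z ^ (n + 1) * g⁻¹ * (z - ε) - z ^ (n + 1 + 1) + z ^ (n + 1) * (κ + ε)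
        = (g * z ^ (n + 1) * g⁻¹ - z ^ (n + 1) + z ^ n * κ) * z
          - (g * z ^ (n + 1) * g⁻¹ - z ^ (n + 1) + z ^ n * κ) * ε + z ^ n * (κ * ε) := by
      rw [pow_succ z (n + 1), add_mul _ (z ^ n * κ) z, mul_assoc (z ^ n) κ z, hκ, pow_succ z n]
      noncomm_ring
    rw [h3]
    exact add_mem (sub_mem (mul_gen_mem_degLT hM ih)
      (degLT_succ_le _ (mul_coeff_mem_degLT ih hcε))) e2

theorem conj_sub_mem (hM : ∀ m ∈ M, z * m - m * z ∈ M) (hc : ∀ c : ℂ, algebraMap ℂ D c ∈ M)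
    {g : D} {η : ℂ} (hg0 : g ≠ 0) (hgz : g * z = (z - algebraMap ℂ D η) * g)
    (hgM : ∀ m ∈ M, g * m = m * g) {n : ℕ} {a : D} (ha : a ∈ degLT M z (n + 1)) :
    g * a * g⁻¹ - a ∈ degLT M z n := by
  induction n generalizing a with
  | zero =>
    rw [mem_degLT_one] at ha
    rw [hgM a ha, mul_inv_cancel_right₀ hg0, sub_self]
    exact zero_mem _
  | succ n ih =>
    obtain ⟨m, hm, h⟩ := mem_degLT_succ.1 ha
    have h1 := mul_coeff_mem_degLT (conj_pow_sub_mem hM hc hg0 hgz n) hm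
    have h2 : g * a * g⁻¹ - a = (g * (a - z ^ (n + 1) * m) * g⁻¹ - (a - z ^ (n + 1) * m))
        + (g * z ^ (n + 1) * g⁻¹ - z ^ (n + 1) + z ^ n * algebraMap ℂ D ((n + 1) * η)) * m
        - z ^ n * (algebraMap ℂ D ((n + 1) * η) * m) := by
      have h3 : g * (z ^ (n + 1) * m) * g⁻¹ = g * z ^ (n + 1) * g⁻¹ * m := by
        have : m * g⁻¹ = g⁻¹ * m := by
          rw [eq_inv_mul_iff_mul_eq₀ hg0, ← mul_assoc, hgM m hm, mul_inv_cancel_right₀ hg0]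
        simp only [mul_assoc, this]
      rw [mul_sub g, sub_mul _ _ g⁻¹, h3]
      noncomm_ring
    rw [h2]
    exact sub_mem (add_mem (degLT_succ_le _ (ih h)) (degLT_succ_le _ h1))
      (pow_mul_mem_degLT (mul_mem (hc _) hm) n)

/-- The difference operator a ↦ g a g⁻¹ - a lowers the degree by exactly one in characteristic zero:
the new leading coefficient is -(n+1)η times the old one. -/
theorem conj_sub_add_mem (hM : ∀ m ∈ M, z * m - m * z ∈ M) (hc : ∀ c : ℂ, algebraMap ℂ D c ∈ M)
    {g : D} {η : ℂ} (hg0 : g ≠ 0) (hgz : g * z = (z - algebraMap ℂ D η) * g)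
    (hgM : ∀ m ∈ M, g * m = m * g) {n : ℕ} {a m : D} (hm : m ∈ M)
    (h : a - z ^ (n + 1) * m ∈ degLT M z (n + 1)) :
    g * a * g⁻¹ - a + z ^ n * (algebraMap ℂ D ((n + 1) * η) * m) ∈ degLT M z n := by
  have h1 := mul_coeff_mem_degLT (conj_pow_sub_mem hM hc hg0 hgz n) hm
  have h3 : g * (z ^ (n + 1) * m) * g⁻¹ = g * z ^ (n + 1) * g⁻¹ * m := by
    have : m * g⁻¹ = g⁻¹ * m := by
      rw [eq_inv_mul_iff_mul_eq₀ hg0, ← mul_assoc, hgM m hm, mul_inv_cancel_right₀ hg0]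
    simp only [mul_assoc, this]
  have h2 : g * a * g⁻¹ - a + z ^ n * (algebraMap ℂ D ((n + 1) * η) * m)
      = (g * (a - z ^ (n + 1) * m) * g⁻¹ - (a - z ^ (n + 1) * m))
      + (g * z ^ (n + 1) * g⁻¹ - z ^ (n + 1) + z ^ n * algebraMap ℂ D ((n + 1) * η)) * m := by
    rw [mul_sub g, sub_mul _ _ g⁻¹, h3]
    noncomm_ring
  rw [h2]
  exact add_mem (conj_sub_mem hM hc hg0 hgz hgM h) h1

/-- The powers of `z` are linearly independent over `M`. -/
theorem eq_zero_of_pow_mul_mem_degLT (hM : ∀ m ∈ M, z * m - m * z ∈ M)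
    (hc : ∀ c : ℂ, algebraMap ℂ D c ∈ M)
    {g : D} {η : ℂ} (hg0 : g ≠ 0) (hη : η ≠ 0) (hgz : g * z = (z - algebraMap ℂ D η) * g)
    (hgM : ∀ m ∈ M, g * m = m * g) {n : ℕ} {m : D} (hm : m ∈ M)
    (h : z ^ n * m ∈ degLT M z n) : m = 0 := by
  induction n generalizing m with
  | zero => simpa [mem_degLT_zero] using h
  | succ n ih =>
    have h1 := conj_sub_mem hM hc hg0 hgz hgM h
    have h2 := conj_sub_add_mem hM hc hg0 hgz hgM (a := z ^ (n + 1) * m) hm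
      (by rw [sub_self]; exact zero_mem _)
    have h3 := ih (mul_mem (hc ((n + 1) * η)) hm) (by
      have := sub_mem h2 h1
      rwa [add_sub_cancel_left] at this)
    have h4 : algebraMap ℂ D ((n + 1) * η) ≠ 0 := by
      rw [Ne, map_eq_zero]
      exact mul_ne_zero (Nat.cast_add_one_ne_zero n) hη
    exact (mul_eq_zero.1 h3).resolve_left h4

/-- A quotient of skew polynomials in `z` with coefficients in `M` which commutes with an element
shifting `z` is a coefficient. -/
theorem mem_coeffs_of_commute (hM : ∀ m ∈ M, z * m - m * z ∈ M)
    (hc : ∀ c : ℂ, algebraMap ℂ D c ∈ M)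
    {g : D} {η : ℂ} (hg : g ∈ M) (hg0 : g ≠ 0) (hη : η ≠ 0)
    (hgz : g * z = (z - algebraMap ℂ D η) * g) (hgM : ∀ m ∈ M, g * m = m * g)
    {S : Set D} (hS : S ⊆ skewPolys M z) {q : D} (hq : q ∈ Subfield.closure S)
    (hgq : g * q = q * g) : q ∈ M := by
  have hgR : g ∈ skewPolys M z := coeff_mem_skewPolys hg
  have hgR' : g⁻¹ ∈ skewPolys M z := coeff_mem_skewPolys (inv_mem hg)
  -- Descent on the degree of a right denominator. Since `q` commutes with `g`, the difference g β
  -- g⁻¹ - β of a denominator is again a denominator; it has smaller degree and is nonzero because β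
  -- is monic of positive degree. At degree zero the denominator is 1.
  have key : ∀ n : ℕ, ∀ b ∈ degLT M z n, b ≠ 0 → q * b ∈ skewPolys M z →
      q ∈ skewPolys M z := by
    intro n
    induction n with
    | zero => exact fun b hb hb0 _ => absurd (mem_degLT_zero.1 hb) hb0
    | succ n ih =>
      intro b hb hb0 hqb
      obtain h | ⟨m, hm, h0, h⟩ := exists_monic_of_mem_degLT hb
      · exact ih b h hb0 hqb
      have hqβ : q * (b * m⁻¹) ∈ skewPolys M z := by
        rw [← mul_assoc]; exact mul_mem hqb (coeff_mem_skewPolys (inv_mem hm))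
      have hβ : b * m⁻¹ ∈ degLT M z (n + 1) := mul_coeff_mem_degLT hb (inv_mem hm)
      generalize b * m⁻¹ = β at *
      cases n with
      | zero =>
        rw [pow_zero, mem_degLT_zero, sub_eq_zero] at h
        simpa [h] using hqβ
      | succ n =>
        refine ih (g * β * g⁻¹ - β) (conj_sub_mem hM hc hg0 hgz hgM hβ) ?_ ?_
        · intro h1
          have h2 := conj_sub_add_mem hM hc hg0 hgz hgM (a := β) (m := 1) (n := n) (one_mem M)
            (by simpa using h)
          rw [h1, zero_add, mul_one] at h2
          have h3 := eq_zero_of_pow_mul_mem_degLT hM hc hg0 hη hgz hgM (hc _) h2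
          rw [map_eq_zero] at h3
          exact mul_ne_zero (Nat.cast_add_one_ne_zero n) hη h3
        · have : q * (g * β * g⁻¹ - β) = g * (q * β) * g⁻¹ - q * β := by
            rw [mul_sub, ← mul_assoc g q, hgq]; simp only [mul_assoc]
          rw [this]
          exact sub_mem (mul_mem (mul_mem hgR hqβ) hgR') hqβ
  obtain ⟨b, hb, hb0, hqb⟩ := exists_fraction hM hS hq
  obtain ⟨n, hn⟩ := (mem_skewPolys_iff hM).1 hb
  obtain ⟨p, hp⟩ := (mem_skewPolys_iff hM).1 (key n b hn hb0 hqb)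
  have h0 : g * q * g⁻¹ - q = 0 := by rw [hgq, mul_inv_cancel_right₀ hg0, sub_self]
  -- Now `q` is a polynomial with zero difference, so a leading coefficient in positive degree would
  -- have to vanish.
  have hdeg : ∀ p : ℕ, q ∈ degLT M z (p + 1) → q ∈ degLT M z 1 := by
    intro p
    induction p with
    | zero => exact id
    | succ p ih =>
      intro hp
      obtain ⟨m, hm, h⟩ := mem_degLT_succ.1 hp
      have h2 := conj_sub_add_mem hM hc hg0 hgz hgM hm h
      rw [h0, zero_add] at h2
      have h3 := eq_zero_of_pow_mul_mem_degLT hM hc hg0 hη hgz hgM (mul_mem (hc _) hm) h2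
      have h4 : algebraMap ℂ D ((p + 1) * η) ≠ 0 := by
        rw [Ne, map_eq_zero]
        exact mul_ne_zero (Nat.cast_add_one_ne_zero p) hη
      have h5 := (mul_eq_zero.1 h3).resolve_left h4
      exact ih (by simpa [h5] using h)
  exact mem_degLT_one.1 (hdeg p (degLT_succ_le p hp))

/-! ### Eigenvectors of the commutator with `z` on polynomials in `y` -/

section Eigenvectors

variable {N : Subfield D} {y : D} {h : ℂ}

/-- The relation [z, y] = h y makes y^n an eigenvector of [z, ·] with eigenvalue n h; for h ≠ 0
these eigenvalues are distinct, which separates the monomials in what follows. -/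
theorem comm_pow_mul (hN : ∀ m ∈ N, ∀ a : D, m * a = a * m)
    (hzy : z * y = y * z + algebraMap ℂ D h * y) (n : ℕ) {m : D} (hm : m ∈ N) :
    z * (y ^ n * m) - y ^ n * m * z = algebraMap ℂ D (n * h) * (y ^ n * m) := by
  have key : z * y ^ n = y ^ n * z + algebraMap ℂ D (n * h) * y ^ n := by
    induction n with
    | zero => simp
    | succ n ih =>
      have e : algebraMap ℂ D ((n + 1 : ℕ) * h)
          = algebraMap ℂ D (n * h) + algebraMap ℂ D h := by
        rw [← map_add]; congr 1; push_cast; ring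
      rw [e, pow_succ, ← mul_assoc, ih, add_mul, mul_assoc _ z, hzy, mul_add, ← mul_assoc _ _ y,
        ← mul_assoc _ _ y, ← (Algebra.commutes h (y ^ n)), ← pow_succ]
      simp only [add_mul, mul_assoc, pow_succ]
      abel
  rw [← mul_assoc, key, mul_assoc _ m z, hN m hm z]
  noncomm_ring

theorem comm_sub_mem_degLT (hN : ∀ m ∈ N, ∀ a : D, m * a = a * m)
    (hc : ∀ c : ℂ, algebraMap ℂ D c ∈ N)
    (hzy : z * y = y * z + algebraMap ℂ D h * y) {n : ℕ} {a : D} (ha : a ∈ degLT N y n) (η : ℂ) :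
    z * a - a * z - algebraMap ℂ D η * a ∈ degLT N y n := by
  induction n generalizing a with
  | zero => rw [mem_degLT_zero] at ha ⊢; simp [ha]
  | succ n ih =>
    obtain ⟨m, hm, ha'⟩ := mem_degLT_succ.1 ha
    refine mem_degLT_succ.2 ⟨algebraMap ℂ D (n * h - η) * m, mul_mem (hc _) hm, ?_⟩
    have h1 := comm_pow_mul hN hzy n hm
    have h2 : y ^ n * (algebraMap ℂ D (n * h - η) * m)
        = algebraMap ℂ D (n * h - η) * (y ^ n * m) := by
      rw [← mul_assoc, ← Algebra.commutes, mul_assoc]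
    have h3 : z * a - a * z - algebraMap ℂ D η * a - y ^ n * (algebraMap ℂ D (n * h - η) * m)
        = z * (a - y ^ n * m) - (a - y ^ n * m) * z - algebraMap ℂ D η * (a - y ^ n * m) := by
      rw [h2, map_sub, sub_mul _ _ (y ^ n * m), ← h1]; noncomm_ring
    rw [h3]
    exact ih ha'

/-- Leading terms of eigenvectors of `[z, ·]`. -/
theorem comm_sub_lead_mem_degLT (hN : ∀ m ∈ N, ∀ a : D, m * a = a * m)
    (hc : ∀ c : ℂ, algebraMap ℂ D c ∈ N)
    (hzy : z * y = y * z + algebraMap ℂ D h * y) {n : ℕ} {a : D}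
    (ha : a ∈ degLT N y (n + 1)) :
    z * a - a * z - algebraMap ℂ D (n * h) * a ∈ degLT N y n := by
  obtain ⟨m, hm, ha'⟩ := mem_degLT_succ.1 ha
  have h1 := comm_pow_mul hN hzy n hm
  have h3 : z * a - a * z - algebraMap ℂ D (n * h) * a
      = z * (a - y ^ n * m) - (a - y ^ n * m) * z
        - algebraMap ℂ D (n * h) * (a - y ^ n * m) := by
    rw [mul_sub (algebraMap ℂ D (n * h)), ← h1]; noncomm_ring
  rw [h3]
  exact comm_sub_mem_degLT hN hc hzy ha' _

theorem eq_zero_of_eigenvector (hN : ∀ m ∈ N, ∀ a : D, m * a = a * m)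
    (hc : ∀ c : ℂ, algebraMap ℂ D c ∈ N)
    (hzy : z * y = y * z + algebraMap ℂ D h * y) {n : ℕ} {a : D} (ha : a ∈ degLT N y n) {η : ℂ}
    (hη : ∀ k < n, η ≠ k * h) (haη : z * a - a * z = algebraMap ℂ D η * a) : a = 0 := by
  induction n with
  | zero => exact mem_degLT_zero.1 ha
  | succ n ih =>
    refine ih ?_ fun k hk => hη k (hk.trans n.lt_succ_self)
    have h1 := comm_sub_lead_mem_degLT hN hc hzy ha
    rw [haη, ← sub_mul, ← map_sub, Algebra.commutes] at h1
    have h2 := mul_coeff_mem_degLT h1 (inv_mem (hc (η - n * h)))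
    rwa [mul_assoc, mul_inv_cancel₀, mul_one] at h2
    rw [Ne, map_eq_zero, sub_eq_zero]
    exact hη n n.lt_succ_self

theorem eq_pow_mul_of_eigenvector (hN : ∀ m ∈ N, ∀ a : D, m * a = a * m)
    (hc : ∀ c : ℂ, algebraMap ℂ D c ∈ N) (hh : h ≠ 0)
    (hzy : z * y = y * z + algebraMap ℂ D h * y) {n p : ℕ} {a : D} (ha : a ∈ degLT N y p)
    (haη : z * a - a * z = algebraMap ℂ D (n * h) * a) : ∃ m ∈ N, a = y ^ n * m := by
  have hinj : ∀ {k l : ℕ}, (k : ℂ) * h = l * h → k = l := fun e =>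
    Nat.cast_injective (mul_right_cancel₀ hh e)
  induction p with
  | zero => exact ⟨0, zero_mem _, by rw [mul_zero]; exact mem_degLT_zero.1 ha⟩
  | succ p ih =>
    by_cases hp : n = p
    · subst hp
      obtain ⟨m, hm, ha'⟩ := mem_degLT_succ.1 ha
      refine ⟨m, hm, sub_eq_zero.1 (eq_zero_of_eigenvector hN hc hzy ha' (η := n * h) ?_ ?_)⟩
      · intro k hk e
        exact hk.ne' (hinj e)
      · have h1 := comm_pow_mul hN hzy n hm
        rw [mul_sub z, sub_mul, mul_sub (algebraMap ℂ D (n * h)), ← h1, ← haη]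
        abel
    · refine ih ?_
      have h1 := comm_sub_lead_mem_degLT hN hc hzy ha
      rw [haη, ← sub_mul, ← map_sub, Algebra.commutes] at h1
      have h2 := mul_coeff_mem_degLT h1 (inv_mem (hc (n * h - p * h)))
      rwa [mul_assoc, mul_inv_cancel₀, mul_one] at h2
      rw [Ne, map_eq_zero, sub_eq_zero]
      exact fun e => hp (hinj e)

/-- The elements of `N(y)` which commute with `z` belong to `N`. -/
theorem mem_constants_of_commute (hN : ∀ m ∈ N, ∀ a : D, m * a = a * m)
    (hc : ∀ c : ℂ, algebraMap ℂ D c ∈ N) (hh : h ≠ 0) (hy : y ≠ 0)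
    (hzy : z * y = y * z + algebraMap ℂ D h * y) {q : D}
    (hq : q ∈ Subfield.closure (insert y (N : Set D))) (hzq : z * q = q * z) : q ∈ N := by
  have hM : ∀ m ∈ N, y * m - m * y ∈ N := fun m hm => by
    rw [hN m hm y, sub_self]; exact zero_mem _
  -- The operator [z, ·] - n h maps denominators of `q` to denominators, because `q` commutes with
  -- `z`, and it kills the term of degree n. Iterating, one reaches an eigenvector, that is, a
  -- denominator which is a monomial.
  have key : ∀ n : ℕ, ∀ b ∈ degLT N y n, b ≠ 0 → q * b ∈ skewPolys N y →
      ∃ k : ℕ, q * y ^ k ∈ skewPolys N y := by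
    intro n
    induction n with
    | zero => exact fun b hb hb0 _ => absurd (mem_degLT_zero.1 hb) hb0
    | succ n ih =>
      intro b hb hb0 hqb
      by_cases h1 : z * b - b * z - algebraMap ℂ D (n * h) * b = 0
      · obtain ⟨m, hm, rfl⟩ := eq_pow_mul_of_eigenvector hN hc hh hzy hb (sub_eq_zero.1 h1)
        have hm0 : m ≠ 0 := by rintro rfl; simp at hb0
        refine ⟨n, ?_⟩
        have := mul_mem hqb (coeff_mem_skewPolys (z := y) (inv_mem hm))
        rwa [mul_assoc, mul_assoc, mul_inv_cancel₀ hm0, mul_one] at this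
      · refine ih _ (comm_sub_lead_mem_degLT hN hc hzy hb) h1 ?_
        obtain ⟨p, hp⟩ := (mem_skewPolys_iff hM).1 hqb
        have h2 := degLT_le_skewPolys (comm_sub_mem_degLT hN hc hzy hp (n * h))
        have h3 : q * (z * b - b * z - algebraMap ℂ D (n * h) * b)
            = z * (q * b) - q * b * z - algebraMap ℂ D (n * h) * (q * b) := by
          rw [← mul_assoc z, hzq, ← mul_assoc (algebraMap ℂ D (n * h)), Algebra.commutes _ q,
            mul_assoc q (algebraMap ℂ D (n * h))]
          noncomm_ring
        rwa [h3]
  have hS : insert y (N : Set D) ⊆ skewPolys N y := Subring.subset_closure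
  obtain ⟨b, hb, hb0, hqb⟩ := exists_fraction hM hS hq
  obtain ⟨n, hn⟩ := (mem_skewPolys_iff hM).1 hb
  obtain ⟨k, hk⟩ := key n b hn hb0 hqb
  obtain ⟨p, hp⟩ := (mem_skewPolys_iff hM).1 hk
  -- The polynomial q y^k is itself an eigenvector of eigenvalue k h, hence of the form y^k m, and
  -- cancelling y^k leaves q = m.
  have h1 : z * (q * y ^ k) - q * y ^ k * z = algebraMap ℂ D (k * h) * (q * y ^ k) := by
    have := comm_pow_mul hN hzy k (one_mem N)
    rw [mul_one] at this
    rw [← mul_assoc, hzq, ← mul_assoc, Algebra.commutes, mul_assoc q (algebraMap ℂ D (k * h)),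
      ← this]
    noncomm_ring
  obtain ⟨m, hm, e⟩ := eq_pow_mul_of_eigenvector hN hc hh hzy hp h1
  rw [← hN m hm] at e
  rwa [mul_right_cancel₀ (pow_ne_zero k hy) e]

end Eigenvectors

end Centralizers

/-! ### Skew derivations are determined by generators -/

section SkewDerivations

variable {D : Type*} [DivisionRing D] [Algebra ℂ D] {T : D →ₗ[ℂ] D} {α β : D →ₐ[ℂ] D}
  {L : Subfield D}

theorem skewDer_one (hT : ∀ a ∈ L, ∀ b ∈ L, T (a * b) = T a * β b + α a * T b) : T 1 = 0 := by
  simpa using hT 1 (one_mem L) 1 (one_mem L)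

/-- A skew derivation vanishes on a division subring if it vanishes on generators. -/
theorem skewDer_eq_zero (hT : ∀ a ∈ L, ∀ b ∈ L, T (a * b) = T a * β b + α a * T b) {S : Set D}
    (hSL : S ⊆ L) (hS : ∀ s ∈ S, T s = 0) {q : D} (hq : q ∈ Subfield.closure S) : T q = 0 := by
  have hL := Subfield.closure_le.2 hSL
  induction hq using Subfield.closure_induction with
  | mem a ha => exact hS a ha
  | one => exact skewDer_one hT
  | add a b _ _ ha hb => simp [ha, hb]
  | neg a _ ha => simp [ha]
  | inv a haS ha =>
    by_cases h0 : a = 0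
    · simp [h0]
    · have h1 := hT a (hL haS) a⁻¹ (inv_mem (hL haS))
      rw [mul_inv_cancel₀ h0, skewDer_one hT, ha, zero_mul, zero_add] at h1
      exact (mul_eq_zero.1 h1.symm).resolve_left (by simpa using h0)
  | mul a b haS hbS ha hb => simp [hT a (hL haS) b (hL hbS), ha, hb]

/-- A skew derivation preserves a division subring if it maps generators into it. -/
theorem skewDer_mem (hT : ∀ a b, T (a * b) = T a * β b + α a * T b)
    (hα : ∀ a ∈ L, α a ∈ L) (hβ : ∀ a ∈ L, β a ∈ L) {S : Set D} (hSL : S ⊆ L)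
    (hS : ∀ s ∈ S, T s ∈ L) {q : D} (hq : q ∈ Subfield.closure S) : T q ∈ L := by
  have hL := Subfield.closure_le.2 hSL
  have h1 : T 1 = 0 := skewDer_one (L := ⊤) fun a _ b _ => hT a b
  induction hq using Subfield.closure_induction with
  | mem a ha => exact hS a ha
  | one => rw [h1]; exact zero_mem L
  | add a b _ _ ha hb => rw [map_add]; exact add_mem ha hb
  | neg a _ ha => rw [map_neg]; exact neg_mem ha
  | inv a haS ha =>
    by_cases h0 : a = 0
    · simp [h0, zero_mem]
    · have h2 := hT a a⁻¹
      have h3 : α a ≠ 0 := by simpa using h0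
      rw [mul_inv_cancel₀ h0, h1, eq_comm, add_comm, ← eq_neg_iff_add_eq_zero] at h2
      rw [(eq_inv_mul_iff_mul_eq₀ h3).2 h2]
      exact mul_mem (inv_mem (hα a (hL haS))) (neg_mem (mul_mem ha (hβ _ (inv_mem (hL haS)))))
  | mul a b haS hbS ha hb =>
    rw [hT]
    exact add_mem (mul_mem ha (hβ _ (hL hbS))) (mul_mem (hα _ (hL haS)) hb)

theorem skewDer_comp_eq_zero {h : ℂ} {I : Type*} [LinearOrder I] {ι : HAlg h I →ₐ[ℂ] D}
    (hT : ∀ a ∈ L, ∀ b ∈ L, T (a * b) = T a * β b + α a * T b) {S : Set I}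
    (hSL : ∀ a ∈ HAlg.sub h S, ι a ∈ L)
    (hx : ∀ j ∈ S, T (ι (HAlg.x j)) = 0) (hy : ∀ j ∈ S, T (ι (HAlg.y j)) = 0)
    {a : HAlg h I} (ha : a ∈ HAlg.sub h S) : T (ι a) = 0 := by
  induction ha using Algebra.adjoin_induction with
  | mem a ha =>
    rcases ha with ⟨j, hj, rfl⟩ | ⟨j, hj, rfl⟩
    · exact hx j hj
    · exact hy j hj
  | algebraMap c => simp [Algebra.algebraMap_eq_smul_one, skewDer_one hT]
  | add a b _ _ ha hb => simp [ha, hb]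
  | mul a b haS hbS ha hb => simp [hT _ (hSL a haS) _ (hSL b hbS), ha, hb]

end SkewDerivations

theorem HAlg.sub_univ {h : ℂ} {I : Type*} [LinearOrder I] (a : HAlg h I) :
    a ∈ HAlg.sub h (Set.univ : Set I) := by
  induction a using HAlg.induction with
  | hc c => exact Subalgebra.algebraMap_mem _ c
  | hx i => exact Algebra.subset_adjoin (Or.inl ⟨i, trivial, rfl⟩)
  | hy i => exact Algebra.subset_adjoin (Or.inr ⟨i, trivial, rfl⟩)
  | hadd a b ha hb => exact add_mem ha hb
  | hmul a b ha hb => exact mul_mem ha hb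

theorem HAlg.x_mem_sub {h : ℂ} {I : Type*} [LinearOrder I] {S : Set I} {j : I} (hj : j ∈ S) :
    HAlg.x j ∈ HAlg.sub h S := Algebra.subset_adjoin (Or.inl ⟨j, hj, rfl⟩)

theorem HAlg.y_mem_sub {h : ℂ} {I : Type*} [LinearOrder I] {S : Set I} {j : I} (hj : j ∈ S) :
    HAlg.y j ∈ HAlg.sub h S := Algebra.subset_adjoin (Or.inr ⟨j, hj, rfl⟩)

/-! ### Commutation relations in the skew field -/

namespace SkewExt

variable {h : ℂ} {I : Type*} [LinearOrder I] {o : I} {D : Type*} [DivisionRing D] [Algebra ℂ D]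
  (Q : SkewExt (h := h) o D)

/-- The tool behind the operator identities on `D` below: the difference of the two sides is a skew
derivation of a suitable type (α, β), so it is enough to test it on the generators and on Σ. -/
theorem skewDer_eq_zero_of_gens {T : D →ₗ[ℂ] D} {α β : D →ₐ[ℂ] D}
    (hT : ∀ a b, T (a * b) = T a * β b + α a * T b)
    (hx : ∀ j, T (Q.ι (HAlg.x j)) = 0) (hy : ∀ j, T (Q.ι (HAlg.y j)) = 0)
    (hs : ∀ s ∈ Q.Sig, T s = 0) (a : D) : T a = 0 := by
  have hT' : ∀ a ∈ (⊤ : Subfield D), ∀ b ∈ (⊤ : Subfield D), T (a * b) = T a * β b + α a * T b :=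
    fun a _ b _ => hT a b
  refine skewDer_eq_zero hT' (S := Set.range Q.ι ∪ Q.Sig) (fun _ _ => Subfield.mem_top _) ?_
    (Q.generated ▸ Subfield.mem_top a)
  rintro _ (⟨b, rfl⟩ | h)
  · exact skewDer_comp_eq_zero hT' (fun _ _ => Subfield.mem_top _) (fun j _ => hx j) (fun j _ => hy j) 
      (HAlg.sub_univ b)
  · exact hs _ h

theorem ι_mem_coeffs {a : HAlg h I} (ha : a ∈ HAlg.sub h ({o}ᶜ : Set I)) : Q.ι a ∈ Q.coeffs :=
  Subfield.subset_closure (Or.inl ⟨a, ha, rfl⟩)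

theorem skewDer_eq_zero_of_coeffs {T : D →ₗ[ℂ] D} {α β : D →ₐ[ℂ] D}
    (hT : ∀ a ∈ Q.coeffs, ∀ b ∈ Q.coeffs, T (a * b) = T a * β b + α a * T b)
    (hx : ∀ j, j ≠ o → T (Q.ι (HAlg.x j)) = 0) (hy : ∀ j, j ≠ o → T (Q.ι (HAlg.y j)) = 0)
    (hs : ∀ s ∈ Q.Sig, T s = 0) {a : D} (ha : a ∈ Q.coeffs) : T a = 0 := by
  refine skewDer_eq_zero hT Subfield.subset_closure ?_ ha
  rintro _ (⟨b, hb, rfl⟩ | h)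
  · exact skewDer_comp_eq_zero hT (fun _ => Q.ι_mem_coeffs) hx hy hb
  · exact hs _ h

theorem K_x (j : I) : Q.K (Q.ι (HAlg.x j)) = Q.ι (HAlg.x j) + h • Q.ι (HAlg.y j) := by
  simp [Q.K_ι]

theorem K_y (j : I) : Q.K (Q.ι (HAlg.y j)) = Q.ι (HAlg.y j) := by
  simp [Q.K_ι]

theorem K_symm_y (j : I) : Q.K.symm (Q.ι (HAlg.y j)) = Q.ι (HAlg.y j) := by
  rw [AlgEquiv.symm_apply_eq, K_y]

theorem K_symm_x (j : I) :
    Q.K.symm (Q.ι (HAlg.x j)) = Q.ι (HAlg.x j) - h • Q.ι (HAlg.y j) := by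
  rw [AlgEquiv.symm_apply_eq, map_sub, map_smul, K_y, K_x, add_sub_cancel_right]

theorem H_x (j : I) : Q.H (Q.ι (HAlg.x j)) = Q.ι (HAlg.x j) := by simp [Q.H_ι]
theorem H_y (j : I) : Q.H (Q.ι (HAlg.y j)) = - Q.ι (HAlg.y j) := by simp [Q.H_ι]
theorem F_x (j : I) : Q.F (Q.ι (HAlg.x j)) = Q.ι (HAlg.y j) := by simp [Q.F_ι]
theorem F_y (j : I) : Q.F (Q.ι (HAlg.y j)) = 0 := by simp [Q.F_ι]
theorem E_x (j : I) : Q.E (Q.ι (HAlg.x j)) = 0 := by simp [Q.E_ι]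
theorem E_y (j : I) : Q.E (Q.ι (HAlg.y j)) = Q.ι (HAlg.x j) := by simp [Q.E_ι]

theorem K_sig {s : D} (hs : s ∈ Q.Sig) : Q.K s = s := (Q.Sig_invariant s hs).1
theorem K_symm_sig {s : D} (hs : s ∈ Q.Sig) : Q.K.symm s = s := by
  rw [AlgEquiv.symm_apply_eq, K_sig Q hs]
theorem F_sig {s : D} (hs : s ∈ Q.Sig) : Q.F s = 0 := (Q.Sig_invariant s hs).2.2.1
theorem H_sig {s : D} (hs : s ∈ Q.Sig) : Q.H s = 0 := (Q.Sig_invariant s hs).2.2.2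

/-- The symmetrized operator `(H K + K H) / 2`, a skew derivation of type `(K², 1)`. -/
noncomputable def Hsym : D →ₗ[ℂ] D :=
  (2 : ℂ)⁻¹ • (Q.H ∘ₗ Q.K.toLinearMap + Q.K.toLinearMap ∘ₗ Q.H)

theorem Hsym_apply (a : D) : Q.Hsym a = (2 : ℂ)⁻¹ • (Q.H (Q.K a) + Q.K (Q.H a)) := rfl

theorem Hsym_mul (a b : D) : Q.Hsym (a * b) = Q.Hsym a * b + Q.K (Q.K a) * Q.Hsym b := by
  simp only [Hsym_apply, map_mul, Q.H_mul, map_add, AlgEquiv.symm_apply_apply,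
    AlgEquiv.apply_symm_apply, smul_mul_assoc, mul_smul_comm, add_mul, mul_add]
  module

theorem Hsym_x (j : I) : Q.Hsym (Q.ι (HAlg.x j)) = Q.ι (HAlg.x j) := by
  simp only [Hsym_apply, K_x, H_x, H_y, map_add, map_smul]
  module

theorem Hsym_y (j : I) : Q.Hsym (Q.ι (HAlg.y j)) = - Q.ι (HAlg.y j) := by
  simp only [Hsym_apply, K_y, H_y, map_neg]
  module

theorem Hsym_sig {s : D} (hs : s ∈ Q.Sig) : Q.Hsym s = 0 := by
  simp [Hsym_apply, K_sig Q hs, H_sig Q hs]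

/-- The operator e^{-hF} is inner, realized by conjugation with any `y_j`: the defect y_j a - K⁻¹(a)
y_j is a skew derivation of type (K⁻¹, 1) killed by the generators. -/
theorem y_mul (j : I) (a : D) : Q.ι (HAlg.y j) * a = Q.K.symm a * Q.ι (HAlg.y j) := by
  have := Q.skewDer_eq_zero_of_gens (T := LinearMap.mulLeft ℂ (Q.ι (HAlg.y j))
      - LinearMap.mulRight ℂ (Q.ι (HAlg.y j)) ∘ₗ Q.K.symm.toLinearMap)
    (α := Q.K.symm) (β := AlgHom.id ℂ D) ?_ ?_ ?_ ?_ a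
  · simpa [sub_eq_zero] using this
  · intro a b
    simp only [LinearMap.sub_apply, LinearMap.comp_apply, LinearMap.mulLeft_apply,
      LinearMap.mulRight_apply, AlgEquiv.toLinearMap_apply, map_mul, AlgHom.id_apply,
      AlgEquiv.coe_toAlgHom]
    noncomm_ring
  · intro i
    simp only [LinearMap.sub_apply, LinearMap.comp_apply, LinearMap.mulLeft_apply,
      LinearMap.mulRight_apply, AlgEquiv.toLinearMap_apply, K_symm_x, sub_mul, smul_mul_assoc,
      ← map_mul]
    rw [HAlg.xy j i, HAlg.yy j i]
    simp only [map_add, map_smul]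
    abel
  · intro i
    simp [K_symm_y, ← map_mul, HAlg.yy i j]
  · intro s hs
    simp [K_symm_sig Q hs, Q.Sig_central s hs]

theorem mul_y (j : I) (a : D) : a * Q.ι (HAlg.y j) = Q.ι (HAlg.y j) * Q.K a := by
  rw [y_mul, AlgEquiv.symm_apply_apply]

/-- The defect is a skew derivation of type (K, 1). The type (K², 1) of `Hsym` is what fits here,
because `y_j` carries K² to K when it is moved across. -/
theorem x_mul (j : I) (a : D) : Q.ι (HAlg.x j) * a =
    Q.K a * Q.ι (HAlg.x j) - h • (Q.ι (HAlg.y j) * Q.Hsym a) := by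
  have := Q.skewDer_eq_zero_of_gens (T := LinearMap.mulLeft ℂ (Q.ι (HAlg.x j))
      - LinearMap.mulRight ℂ (Q.ι (HAlg.x j)) ∘ₗ Q.K.toLinearMap
      + h • (LinearMap.mulLeft ℂ (Q.ι (HAlg.y j)) ∘ₗ Q.Hsym))
    (α := Q.K) (β := AlgHom.id ℂ D) ?_ ?_ ?_ ?_ a
  · simp only [LinearMap.sub_apply, LinearMap.add_apply, LinearMap.smul_apply,
      LinearMap.comp_apply, LinearMap.mulLeft_apply,
      LinearMap.mulRight_apply, AlgEquiv.toLinearMap_apply] at this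
    rw [← sub_eq_zero, ← this]
    abel
  · intro a b
    simp only [LinearMap.sub_apply, LinearMap.add_apply, LinearMap.smul_apply,
      LinearMap.comp_apply, LinearMap.mulLeft_apply,
      LinearMap.mulRight_apply, AlgEquiv.toLinearMap_apply, map_mul, AlgHom.id_apply,
      AlgEquiv.coe_toAlgHom, Hsym_mul, mul_add, add_mul, sub_mul, mul_sub, smul_add, smul_mul_assoc,
      mul_smul_comm, ← mul_assoc, mul_y]
    abel
  · intro i
    simp only [LinearMap.sub_apply, LinearMap.add_apply, LinearMap.smul_apply,
      LinearMap.comp_apply, LinearMap.mulLeft_apply,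
      LinearMap.mulRight_apply, AlgEquiv.toLinearMap_apply, K_x, Hsym_x, add_mul,
      smul_mul_assoc, ← map_mul]
    rw [HAlg.xx i j]
    simp only [map_add, map_sub, map_smul]
    abel
  · intro i
    simp only [LinearMap.sub_apply, LinearMap.add_apply, LinearMap.smul_apply,
      LinearMap.comp_apply, LinearMap.mulLeft_apply,
      LinearMap.mulRight_apply, AlgEquiv.toLinearMap_apply, K_y, Hsym_y, mul_neg, smul_neg,
      ← map_mul]
    rw [HAlg.xy i j, HAlg.yy i j]
    simp only [map_add, map_smul]
    abel
  · intro s hs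
    simp [K_sig Q hs, Hsym_sig Q hs, Q.Sig_central s hs]

theorem F_K (a : D) : Q.F (Q.K a) = Q.K (Q.F a) := by
  have := Q.skewDer_eq_zero_of_gens (T := Q.F ∘ₗ Q.K.toLinearMap - Q.K.toLinearMap ∘ₗ Q.F)
    (α := Q.K) (β := Q.K) ?_ ?_ ?_ ?_ a
  · simpa [sub_eq_zero] using this
  · intro a b
    simp [Q.F_mul, mul_sub, sub_mul]
    abel
  · intro i; simp [K_x, F_x, F_y, K_y]
  · intro i; simp [F_y, K_y]
  · intro s hs; simp [K_sig Q hs, F_sig Q hs]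

theorem F_K_symm (a : D) : Q.F (Q.K.symm a) = Q.K.symm (Q.F a) := by
  rw [AlgEquiv.eq_symm_apply, ← F_K, AlgEquiv.apply_symm_apply]

/-- `[H, F] = - (e^{hF} - e^{-hF}) / h`. -/
theorem H_F (a : D) : h • (Q.H (Q.F a) - Q.F (Q.H a)) = Q.K.symm a - Q.K a := by
  have := Q.skewDer_eq_zero_of_gens (T := h • (Q.H ∘ₗ Q.F - Q.F ∘ₗ Q.H)
      + (Q.K.toLinearMap - Q.K.symm.toLinearMap))
    (α := Q.K) (β := Q.K.symm) ?_ ?_ ?_ ?_ a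
  · simp only [LinearMap.sub_apply, LinearMap.add_apply, LinearMap.smul_apply,
      LinearMap.comp_apply, AlgEquiv.toLinearMap_apply] at this
    rw [← sub_eq_zero, ← this]
    abel
  · intro a b
    simp only [LinearMap.sub_apply, LinearMap.add_apply, LinearMap.smul_apply,
      LinearMap.comp_apply, AlgEquiv.toLinearMap_apply, Q.F_mul, Q.H_mul, map_add, map_mul,
      AlgEquiv.coe_toAlgHom, F_K, F_K_symm, mul_add, add_mul, sub_mul, mul_sub, smul_add, smul_sub,
      smul_mul_assoc, mul_smul_comm]
    abel
  · intro i
    simp only [LinearMap.sub_apply, LinearMap.add_apply, LinearMap.smul_apply,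
      LinearMap.comp_apply, AlgEquiv.toLinearMap_apply, K_x, K_symm_x, F_x, H_x, H_y]
    module
  · intro i
    simp [K_y, K_symm_y, F_y, H_y]
  · intro s hs
    simp [K_sig Q hs, K_symm_sig Q hs, F_sig Q hs, H_sig Q hs]

theorem Hsym_K (a : D) : Q.Hsym (Q.K a) = Q.K (Q.Hsym a) + Q.K a - Q.K (Q.K (Q.K a)) := by
  have := Q.skewDer_eq_zero_of_gens (T := Q.Hsym ∘ₗ Q.K.toLinearMap
      - Q.K.toLinearMap ∘ₗ Q.Hsym - Q.K.toLinearMap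
      + Q.K.toLinearMap ∘ₗ Q.K.toLinearMap ∘ₗ Q.K.toLinearMap)
    (α := (Q.K : D →ₐ[ℂ] D).comp ((Q.K : D →ₐ[ℂ] D).comp (Q.K : D →ₐ[ℂ] D)))
    (β := Q.K) ?_ ?_ ?_ ?_ a
  · simp only [LinearMap.sub_apply, LinearMap.add_apply,
      LinearMap.comp_apply, AlgEquiv.toLinearMap_apply] at this
    rw [← sub_eq_zero, ← this]
    abel
  · intro a b
    simp only [LinearMap.sub_apply, LinearMap.add_apply, AlgHom.comp_apply,
      LinearMap.comp_apply, AlgEquiv.toLinearMap_apply, Hsym_mul, map_add, map_mul,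
      AlgEquiv.coe_toAlgHom, mul_add, add_mul, sub_mul, mul_sub]
    abel
  · intro i
    simp only [LinearMap.sub_apply, LinearMap.add_apply,
      LinearMap.comp_apply, AlgEquiv.toLinearMap_apply, K_x, K_y, map_add, map_smul, Hsym_x,
      Hsym_y]
    module
  · intro i
    simp [K_y, Hsym_y]
  · intro s hs
    simp [K_sig Q hs, Hsym_sig Q hs]

end SkewExt

/-! ## A faithful family of central elements -/

section Representation

variable {h : ℂ} {I : Type*} [LinearOrder I] {R : Type*} [CommRing R] [Algebra ℂ R]

/-- The operator `y = u S`, where `S` is the shift of sequences. -/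
noncomputable def yOp (u : R) : Module.End ℂ (ℤ → R) where
  toFun f n := u * f (n - 1)
  map_add' f g := by ext n; simp [mul_add]
  map_smul' c f := by ext n; simp

/-- The operator `x = u z S + c S⁻¹`, where `z` is `h` times the index. -/
noncomputable def xOp (h : ℂ) (u c : R) : Module.End ℂ (ℤ → R) where
  toFun f n := u * algebraMap ℂ R (h * n) * f (n - 1) + c * f (n + 1)
  map_add' f g := by ext n; simp [mul_add]; ring
  map_smul' c f := by ext n; simp

@[simp] theorem yOp_apply (u : R) (f : ℤ → R) (n : ℤ) : yOp u f n = u * f (n - 1) := rfl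

@[simp] theorem xOp_apply (u c : R) (f : ℤ → R) (n : ℤ) :
    xOp h u c f n = u * algebraMap ℂ R (h * n) * f (n - 1) + c * f (n + 1) := rfl

/-- The representation of `H_I` with `y_i = u_i S`, `x_i = u_i z S + c_i S⁻¹`. -/
noncomputable def shiftRep (h : ℂ) (u c : I → R) : HAlg h I →ₐ[ℂ] Module.End ℂ (ℤ → R) :=
  HAlg.lift (fun i => xOp h (u i) (c i)) (fun i => yOp (u i))
    (by intro i j; ext f n; simp; ring)
    (by
      intro i j; ext f n
      simp [Algebra.smul_def]
      ring)
    (by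
      intro i j; ext f n
      simp [Algebra.smul_def]
      ring_nf)

theorem shiftRep_x (u c : I → R) (i : I) : shiftRep h u c (HAlg.x i) = xOp h (u i) (c i) :=
  HAlg.lift_x ..

theorem shiftRep_y (u c : I → R) (i : I) : shiftRep h u c (HAlg.y i) = yOp (u i) :=
  HAlg.lift_y ..

theorem HAlg.y_ne_zero (e : I) : (HAlg.y e : HAlg h I) ≠ 0 := by
  intro h0
  have h1 := shiftRep_y (h := h) (R := ℂ) (fun _ : I => 1) (fun _ => 0) e
  rw [h0, map_zero] at h1
  have h2 := congrFun (LinearMap.congr_fun h1 (fun _ => (1 : ℂ))) 0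
  simp at h2

end Representation

/-! ### Ratios and brackets of points -/

namespace SkewExt

variable {h : ℂ} {I : Type*} [LinearOrder I] {o : I} {D : Type*} [DivisionRing D] [Algebra ℂ D]
  (Q : SkewExt (h := h) o D)

/-- `X`, `Y` have the same commutation relations with the elements of `S` as `x_j`, `y_j`. -/
structure PointOn (S : Set D) (X Y : D) : Prop where
  y_mul : ∀ l ∈ S, Y * l = Q.K.symm l * Y
  x_mul : ∀ l ∈ S, X * l = Q.K l * X - h • (Y * Q.Hsym l)

/-- `X Y' - Y X' - h Y Y'`. -/
def bracket (_ : SkewExt (h := h) o D) (X Y X' Y' : D) : D := X * Y' - Y * X' - h • (Y * Y')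

theorem pointOn_gens (S : Set D) (j : I) : Q.PointOn S (Q.ι (HAlg.x j)) (Q.ι (HAlg.y j)) :=
  ⟨fun l _ => Q.y_mul j l, fun l _ => Q.x_mul j l⟩

variable {Q}

/-- Passing `l` through the two products produces terms Y Hsym(K⁻¹ l) Y' and Y K⁻¹(Hsym l) Y'. By
`Hsym_K` they differ by Y (K⁻¹ l - K l) Y', which is compensated by the correction term h Y Y' of
the bracket. -/
theorem PointOn.bracket_comm {S : Set D} {X Y X' Y' : D} (hP : Q.PointOn S X Y)
    (hP' : Q.PointOn S X' Y') {l : D} (hl : l ∈ S) (hKl : Q.K l ∈ S) (hKl' : Q.K.symm l ∈ S)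
    (hHl : Q.Hsym l ∈ S) : Q.bracket X Y X' Y' * l = l * Q.bracket X Y X' Y' := by
  have h1 : X * Y' * l = l * (X * Y') - h • (Y * Q.Hsym (Q.K.symm l) * Y') := by
    rw [mul_assoc, hP'.y_mul l hl, ← mul_assoc, hP.x_mul _ hKl', AlgEquiv.apply_symm_apply,
      sub_mul, smul_mul_assoc, mul_assoc l]
  have h2 : Y * X' * l = l * (Y * X') - h • (Y * Q.K.symm (Q.Hsym l) * Y') := by
    rw [mul_assoc, hP'.x_mul l hl, hP'.y_mul _ hHl, mul_sub, ← mul_assoc Y, hP.y_mul _ hKl,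
      AlgEquiv.symm_apply_apply, mul_smul_comm, mul_assoc l, mul_assoc Y]
  have h3 : Y * Y' * l = Y * Q.K.symm l * Y' := by
    rw [mul_assoc, hP'.y_mul l hl, mul_assoc]
  have h4 : l * (Y * Y') = Y * Q.K l * Y' := by
    rw [hP.y_mul _ hKl, AlgEquiv.symm_apply_apply, mul_assoc]
  have h5 : Q.K.symm (Q.Hsym l) = Q.Hsym (Q.K.symm l) + Q.K.symm l - Q.K l := by
    rw [AlgEquiv.symm_apply_eq]
    have := Q.Hsym_K (Q.K.symm l)
    simp only [map_add, map_sub, AlgEquiv.apply_symm_apply] at this ⊢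
    exact this
  simp only [bracket, sub_mul, mul_sub, smul_mul_assoc, mul_smul_comm, h1, h2, h3, h4, h5,
    mul_add, add_mul]
  module

theorem PointOn.ratio_comm {S : Set D} {X Y X' Y' : D} (hP : Q.PointOn S X Y)
    (hP' : Q.PointOn S X' Y') (hY' : Y' ≠ 0) {l : D} (hKl : Q.K l ∈ S) :
    Y * Y'⁻¹ * l = l * (Y * Y'⁻¹) := by
  have h1 : Y'⁻¹ * l = Q.K l * Y'⁻¹ := by
    rw [inv_mul_eq_iff_eq_mul₀ hY', ← mul_assoc, hP'.y_mul _ hKl, AlgEquiv.symm_apply_apply,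
      mul_inv_cancel_right₀ hY']
  rw [mul_assoc, h1, ← mul_assoc, hP.y_mul _ hKl, AlgEquiv.symm_apply_apply, mul_assoc]

variable (Q)

theorem ι_y_ne_zero (e : I) : Q.ι (HAlg.y e) ≠ 0 := by
  rw [Ne, map_eq_zero_iff _ Q.ι_injective]
  exact HAlg.y_ne_zero e

/-- The central element `y_j y_e⁻¹`. -/
noncomputable def ratio (e j : I) : Subring.center D :=
  ⟨Q.ι (HAlg.y j) * (Q.ι (HAlg.y e))⁻¹, Subring.mem_center_iff.2 fun _ =>
    ((Q.pointOn_gens Set.univ j).ratio_comm (Q.pointOn_gens _ e) (Q.ι_y_ne_zero e)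
      trivial).symm⟩

/-- The central element `x_j y_e - y_j x_e - h y_j y_e`. -/
noncomputable def brac (e j : I) : Subring.center D :=
  ⟨Q.bracket (Q.ι (HAlg.x j)) (Q.ι (HAlg.y j)) (Q.ι (HAlg.x e)) (Q.ι (HAlg.y e)),
    Subring.mem_center_iff.2 fun _ => ((Q.pointOn_gens Set.univ j).bracket_comm (Q.pointOn_gens _ e) trivial trivial trivial
        trivial).symm⟩

theorem ratio_mul (e j : I) : (Q.ratio e j : D) * Q.ι (HAlg.y e) = Q.ι (HAlg.y j) :=
  inv_mul_cancel_right₀ (Q.ι_y_ne_zero e) _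

theorem y_eq (e j : I) : Q.ι (HAlg.y j) = Q.ι (HAlg.y e) * Q.ratio e j := by
  rw [← ratio_mul Q e j]
  exact (Subring.mem_center_iff.1 (Q.ratio e j).2 _).symm

theorem brac_eq (e j : I) : (Q.brac e j : D) =
    Q.ι (HAlg.x j * HAlg.y e - HAlg.y j * HAlg.x e - h • (HAlg.y j * HAlg.y e)) := by
  simp [brac, bracket]

/-- A pair is recovered from its ratio and its bracket with (x_e, y_e). It serves both for
generators, giving `x_eq`, and for coordinates of linear forms, giving the value of a polarization
at x_o. -/
theorem ratio_mul_add_bracket_mul (e : I) (X Y : D) :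
    Y * (Q.ι (HAlg.y e))⁻¹ * Q.ι (HAlg.x e) +
      Q.bracket X Y (Q.ι (HAlg.x e)) (Q.ι (HAlg.y e)) * (Q.ι (HAlg.y e))⁻¹ = X := by
  have h0 := Q.ι_y_ne_zero e
  have h1 : (Q.ι (HAlg.y e))⁻¹ * Q.ι (HAlg.x e) =
      Q.ι (HAlg.x e) * (Q.ι (HAlg.y e))⁻¹ + algebraMap ℂ D h := by
    have h2 := congrArg Q.ι (HAlg.xy_self (h := h) e)
    simp only [map_mul, map_add, map_smul] at h2
    apply mul_right_cancel₀ h0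
    rw [add_mul, inv_mul_cancel_right₀ h0, mul_assoc, h2, mul_add, inv_mul_cancel_left₀ h0,
      mul_smul_comm, inv_mul_cancel_left₀ h0, Algebra.smul_def]
  simp only [bracket, sub_mul, mul_assoc, h1, mul_inv_cancel₀ h0,
    mul_add, mul_one, Algebra.commutes h, Algebra.smul_def]
  rw [mul_inv_cancel_left₀ h0]
  abel

theorem x_eq (e j : I) : Q.ι (HAlg.x j) =
    Q.ι (HAlg.x e) * Q.ratio e j + (Q.ι (HAlg.y e))⁻¹ * Q.brac e j := by
  rw [Subring.mem_center_iff.1 (Q.brac e j).2, Subring.mem_center_iff.1 (Q.ratio e j).2]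
  exact (Q.ratio_mul_add_bracket_mul e _ _).symm

end SkewExt

noncomputable instance Subring.centerAlgebra {D : Type*} [DivisionRing D] [Algebra ℂ D] :
    Algebra ℂ (Subring.center D) :=
  RingHom.toAlgebra ((algebraMap ℂ D).codRestrict (Subring.center D) fun c =>
    Subring.mem_center_iff.2 fun a => (Algebra.commutes c a).symm)

theorem Subring.coe_center_algebraMap {D : Type*} [DivisionRing D] [Algebra ℂ D] (c : ℂ) :
    ((algebraMap ℂ (Subring.center D) c : Subring.center D) : D) = algebraMap ℂ D c := rfl


namespace SkewExt

variable {h : ℂ} {I : Type*} [LinearOrder I] {o : I} {D : Type*} [DivisionRing D] [Algebra ℂ D]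
  (Q : SkewExt (h := h) o D)

/-- The central elements `y_j y_e⁻¹` and `x_j y_e - y_j x_e - h y_j y_e` for `j ≠ e`. -/
noncomputable def centralFamily (e : I) (i : {j : I // j ≠ e} × Bool) : Subring.center D :=
  if i.2 then Q.brac e i.1 else Q.ratio e i.1

/-- The representation of `H_I` whose parameters are independent variables. -/
noncomputable def genericRep (h : ℂ) (e : I) :
    HAlg h I →ₐ[ℂ] Module.End ℂ (ℤ → MvPolynomial ({j : I // j ≠ e} × Bool) ℂ) :=
  shiftRep h (fun j => if hj : j = e then 1 else MvPolynomial.X (⟨j, hj⟩, false))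
    (fun j => if hj : j = e then 0 else MvPolynomial.X (⟨j, hj⟩, true))

/-- A power of `y_e` clears the denominators in a polynomial of ratios and brackets. With u_e = 1
and c_e = 0 in the shift representation, the bracket of index j acts as multiplication by the
variable c_j, and y_j as the variable u_j times a shift. -/
theorem exists_genericRep (e : I) (p : MvPolynomial ({j : I // j ≠ e} × Bool) ℂ) :
    ∃ (N : ℕ) (g : HAlg h I),
      Q.ι g = (MvPolynomial.aeval (Q.centralFamily e) p : Subring.center D) *
        Q.ι (HAlg.y e) ^ N ∧ ∀ f n, genericRep h e g f n = p * f (n - N) := by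
  have hye : ∀ f n, genericRep h e (HAlg.y e) f n = f (n - 1) := by
    intro f n
    simp [genericRep, shiftRep_y]
  have hpow : ∀ (N : ℕ) f n, genericRep h e (HAlg.y e ^ N) f n = f (n - N) := by
    intro N
    induction N with
    | zero => simp
    | succ N ih =>
      intro f n
      rw [pow_succ, map_mul, Module.End.mul_apply, ih, hye]
      congr 1; push_cast; ring
  induction p using MvPolynomial.induction_on with
  | C c => exact ⟨0, algebraMap ℂ _ c, by simp [Subring.coe_center_algebraMap], fun f n => by
      simp [Module.algebraMap_end_apply, MvPolynomial.smul_eq_C_mul]⟩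
  | add p q hp hq =>
    obtain ⟨N, a, ha, ha'⟩ := hp
    obtain ⟨k, b, hb, hb'⟩ := hq
    refine ⟨N + k, a * HAlg.y e ^ k + b * HAlg.y e ^ N, ?_, fun f n => ?_⟩
    · simp only [map_add, map_mul, map_pow, ha, hb, Subring.coe_add, add_mul, mul_assoc,
        ← pow_add]
      rw [add_comm k N]
    · simp only [map_add, map_mul, LinearMap.add_apply, Pi.add_apply, Module.End.mul_apply, ha',
        hb', hpow, add_mul]
      push_cast
      rw [sub_sub, sub_sub, add_comm (k : ℤ) N]
  | mul_X p i hp =>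
    obtain ⟨N, a, ha, ha'⟩ := hp
    obtain ⟨⟨j, hj⟩, b⟩ := i
    have hcen := fun {z : D} => (Subring.mem_center_iff (R := D) (z := z)).1
    cases b with
    | false =>
      refine ⟨N + 1, a * HAlg.y j, ?_, fun f n => ?_⟩
      · rw [map_mul, ha, y_eq Q e j, map_mul, MvPolynomial.aeval_X]
        simp only [Subring.coe_mul, centralFamily, Bool.false_eq_true, if_false, pow_succ]
        rw [mul_assoc _ (Q.ratio e j : D), ← hcen (Q.ratio e j).2]
        simp only [mul_assoc]
      · rw [map_mul, Module.End.mul_apply, ha']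
        simp [genericRep, shiftRep_y, hj, mul_assoc]
        left; congr 1; ring
    | true =>
      refine ⟨N, a * (HAlg.x j * HAlg.y e - HAlg.y j * HAlg.x e - h • (HAlg.y j * HAlg.y e)),
        ?_, fun f n => ?_⟩
      · rw [map_mul, ha, ← brac_eq, map_mul, MvPolynomial.aeval_X]
        simp only [Subring.coe_mul, centralFamily, if_true]
        rw [mul_assoc _ (Q.brac e j : D), ← hcen (Q.brac e j).2]
        simp only [mul_assoc]
      · rw [map_mul, Module.End.mul_apply, ha']
        simp [genericRep, shiftRep_y, shiftRep_x, hj, Algebra.smul_def]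
        ring_nf

/-- A relation p = 0 makes the cleared element of `H_I` zero, since `H_I` embeds; but it acts on the
constant sequence 1 by multiplication by p. -/
theorem algebraicIndependent_centralFamily (e : I) :
    AlgebraicIndependent ℂ (Q.centralFamily e) := by
  rw [AlgebraicIndependent, injective_iff_map_eq_zero]
  intro p hp
  obtain ⟨N, g, hg, hg'⟩ := Q.exists_genericRep e p
  rw [hp, Subring.coe_zero, zero_mul, map_eq_zero_iff _ Q.ι_injective] at hg
  simpa [hg] using (hg' (fun _ => 1) 0).symm

end SkewExt

/-- Central elements which are linearly independent over the constants of a division subring `L`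
are linearly independent over `L`. -/
theorem eq_zero_of_sum_mul_central {D ι : Type*} [DivisionRing D] {L N : Subfield D}
    (hLN : ∀ q ∈ L, (∀ l ∈ L, l * q = q * l) → q ∈ N) {t : ι → Subring.center D}
    (ht : ∀ (s : Finset ι) (l : ι → D), (∀ i, l i ∈ N) → ∑ i ∈ s, l i * (t i : D) = 0 →
      ∀ i ∈ s, l i = 0)
    (s : Finset ι) (l : ι → D) (hl : ∀ i, l i ∈ L) (h : ∑ i ∈ s, l i * (t i : D) = 0) :
    ∀ i ∈ s, l i = 0 := by
  classical
  induction s using Finset.strongInduction generalizing l with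
  | H s ih =>
    intro i hi
    by_contra hli
    -- Shortest relation argument: normalize one coefficient to 1. The commutator with d ∈ L then
    -- has one term fewer, so it is trivial; hence all coefficients commute with L and lie in N.
    set l' : ι → D := fun j => (l i)⁻¹ * l j with hl'
    have hl'L : ∀ j, l' j ∈ L := fun j => mul_mem (inv_mem (hl i)) (hl j)
    have hsum : ∑ j ∈ s, l' j * (t j : D) = 0 := by
      simp only [hl', mul_assoc, ← Finset.mul_sum, h, mul_zero]
    have h1 : l' i = 1 := inv_mul_cancel₀ hli
    have hcen : ∀ j ∈ s, l' j ∈ N := by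
      intro j hj
      refine hLN _ (hl'L j) fun d hd => ?_
      by_cases hji : j = i
      · rw [hji, h1, mul_one, one_mul]
      have h2 : ∑ k ∈ s.erase i, (d * l' k - l' k * d) * (t k : D) = 0 := by
        rw [Finset.sum_erase _ (by rw [h1]; simp)]
        have h3 : ∀ k, (d * l' k - l' k * d) * (t k : D)
            = d * (l' k * (t k : D)) - l' k * (t k : D) * d := by
          intro k
          rw [sub_mul, mul_assoc (l' k) d, Subring.mem_center_iff.1 (t k).2 d]
          simp only [mul_assoc]
        rw [Finset.sum_congr rfl fun k _ => h3 k, Finset.sum_sub_distrib, ← Finset.mul_sum,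
          ← Finset.sum_mul, hsum]
        simp
      exact sub_eq_zero.1 (ih _ (Finset.erase_ssubset hi) (fun k => d * l' k - l' k * d)
        (fun k => sub_mem (mul_mem hd (hl'L k)) (mul_mem (hl'L k) hd)) h2 j
        (Finset.mem_erase.2 ⟨hji, hj⟩))
    have h4 := ht s (fun j => if j ∈ s then l' j else 0)
      (fun j => by split_ifs with hj; exacts [hcen j hj, zero_mem _])
      (by rw [← hsum]; exact Finset.sum_congr rfl fun j hj => by simp [hj]) i hi
    simp [hi, h1] at h4

/-! ### The division ring generated by constants and one pair of generators -/

namespace SkewExt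

variable {h : ℂ} {I : Type*} [LinearOrder I] {o : I} {D : Type*} [DivisionRing D] [Algebra ℂ D]
  (Q : SkewExt (h := h) o D)

/-- The element `z_e = x_e y_e⁻¹`. -/
noncomputable def slope (e : I) : D := Q.ι (HAlg.x e) * (Q.ι (HAlg.y e))⁻¹

theorem slope_mul (e : I) : Q.slope e * Q.ι (HAlg.y e) = Q.ι (HAlg.x e) :=
  inv_mul_cancel_right₀ (Q.ι_y_ne_zero e) _

theorem slope_y (e : I) : Q.slope e * Q.ι (HAlg.y e) =
    Q.ι (HAlg.y e) * Q.slope e + algebraMap ℂ D h * Q.ι (HAlg.y e) := by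
  apply mul_right_cancel₀ (Q.ι_y_ne_zero e)
  have h2 := congrArg Q.ι (HAlg.xy_self (h := h) e)
  simp only [map_mul, map_add, map_smul] at h2
  rw [slope_mul, h2, add_mul, mul_assoc _ (Q.slope e), slope_mul, Algebra.smul_def, mul_assoc]

theorem K_slope (e : I) : Q.K (Q.slope e) = Q.slope e + algebraMap ℂ D h := by
  rw [slope, map_mul, map_inv₀, K_x, K_y, add_mul, smul_mul_assoc,
    mul_inv_cancel₀ (Q.ι_y_ne_zero e), Algebra.algebraMap_eq_smul_one]

/-- The division subring generated by `N`, `y_e` and `z_e`. -/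
def planeField (e : I) (N : Subfield D) : Subfield D :=
  Subfield.closure (insert (Q.slope e) (insert (Q.ι (HAlg.y e)) (N : Set D)))

variable {Q}

section PlaneField

variable {e : I} {N : Subfield D}

theorem slope_mem_planeField : Q.slope e ∈ Q.planeField e N :=
  Subfield.subset_closure (Or.inl rfl)

theorem y_mem_planeField : Q.ι (HAlg.y e) ∈ Q.planeField e N :=
  Subfield.subset_closure (Or.inr (Or.inl rfl))

theorem const_mem_planeField {m : D} (hm : m ∈ N) : m ∈ Q.planeField e N :=
  Subfield.subset_closure (Or.inr (Or.inr hm))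

theorem slope_comm_mem (hN : ∀ m ∈ N, ∀ a : D, m * a = a * m)
    (hc : ∀ c : ℂ, algebraMap ℂ D c ∈ N) {m : D}
    (hm : m ∈ Subfield.closure (insert (Q.ι (HAlg.y e)) (N : Set D))) :
    Q.slope e * m - m * Q.slope e ∈ Subfield.closure (insert (Q.ι (HAlg.y e)) (N : Set D)) := by
  set M := Subfield.closure (insert (Q.ι (HAlg.y e)) (N : Set D))
  have hNM : ∀ m ∈ N, m ∈ M := fun m hm => Subfield.subset_closure (Or.inr hm)
  have hyM : Q.ι (HAlg.y e) ∈ M := Subfield.subset_closure (Or.inl rfl)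
  induction hm using Subfield.closure_induction with
  | mem a ha =>
    rcases ha with rfl | ha
    · rw [slope_y, add_sub_cancel_left]
      exact mul_mem (hNM _ (hc h)) hyM
    · rw [hN a ha, sub_self]
      exact zero_mem _
  | one => simp [zero_mem]
  | add a b _ _ ha hb =>
    have := add_mem ha hb
    rwa [show Q.slope e * (a + b) - (a + b) * Q.slope e = Q.slope e * a - a * Q.slope e
      + (Q.slope e * b - b * Q.slope e) by noncomm_ring]
  | neg a _ ha =>
    have := neg_mem ha
    rwa [show Q.slope e * -a - -a * Q.slope e = -(Q.slope e * a - a * Q.slope e) by noncomm_ring]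
  | inv a ham ha =>
    by_cases h0 : a = 0
    · simp [h0, zero_mem]
    have := mul_mem (mul_mem (inv_mem ham) (neg_mem ha)) (inv_mem ham)
    have e1 : a⁻¹ * -(Q.slope e * a - a * Q.slope e) * a⁻¹
        = Q.slope e * a⁻¹ - a⁻¹ * Q.slope e := by
      simp only [mul_neg, neg_mul, mul_sub, sub_mul, mul_assoc, mul_inv_cancel₀ h0, mul_one,
        inv_mul_cancel_left₀ h0]
      abel
    rwa [e1] at this
  | mul a b ham hbm ha hb =>
    have := add_mem (mul_mem ha hbm) (mul_mem ham hb)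
    rwa [show Q.slope e * (a * b) - a * b * Q.slope e = (Q.slope e * a - a * Q.slope e) * b
      + a * (Q.slope e * b - b * Q.slope e) by noncomm_ring]

theorem y_comm_of_mem (hN : ∀ m ∈ N, ∀ a : D, m * a = a * m) {m : D}
    (hm : m ∈ Subfield.closure (insert (Q.ι (HAlg.y e)) (N : Set D))) :
    Q.ι (HAlg.y e) * m = m * Q.ι (HAlg.y e) := by
  change Commute (Q.ι (HAlg.y e)) m
  induction hm using Subfield.closure_induction with
  | mem a ha =>
    rcases ha with rfl | ha
    · exact Commute.refl _
    · exact (hN a ha _).symm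
  | one => exact Commute.one_right _
  | add a b _ _ ha hb => exact ha.add_right hb
  | neg a _ ha => exact ha.neg_right
  | inv a _ ha => exact ha.inv_right₀
  | mul a b _ _ ha hb => exact ha.mul_right hb

/-- The elements of the division ring generated by `N`, `x_e`, `y_e` which are fixed by `e^{2hF}`
belong to `N(y_e)`. -/
theorem mem_of_K_K_eq (hN : ∀ m ∈ N, ∀ a : D, m * a = a * m)
    (hc : ∀ c : ℂ, algebraMap ℂ D c ∈ N) (hh : h ≠ 0) {q : D} (hq : q ∈ Q.planeField e N)
    (hK : Q.K (Q.K q) = q) :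
    q ∈ Subfield.closure (insert (Q.ι (HAlg.y e)) (N : Set D)) := by
  set M := Subfield.closure (insert (Q.ι (HAlg.y e)) (N : Set D)) with hMdef
  have hNM : ∀ m ∈ N, m ∈ M := fun m hm => Subfield.subset_closure (Or.inr hm)
  have hyM : Q.ι (HAlg.y e) ∈ M := Subfield.subset_closure (Or.inl rfl)
  -- As y_e conjugates by K⁻¹, being fixed by K² means commuting with y_e², and y_e² shifts the
  -- slope by 2h.
  refine mem_coeffs_of_commute (M := M) (z := Q.slope e) (g := Q.ι (HAlg.y e) ^ 2) (η := 2 * h)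
    (fun m hm => slope_comm_mem hN hc hm) (fun c => hNM _ (hc c)) (pow_mem hyM 2)
    (pow_ne_zero 2 (Q.ι_y_ne_zero e)) (mul_ne_zero two_ne_zero hh) ?_ ?_ ?_ hq ?_
  · have h1 := Q.slope_y e
    have h2 : Q.ι (HAlg.y e) * Q.slope e = (Q.slope e - algebraMap ℂ D h) * Q.ι (HAlg.y e) := by
      rw [sub_mul, h1]; abel
    rw [pow_two, mul_assoc, h2, ← mul_assoc, mul_sub, h2, ← Algebra.commutes, ← sub_mul, two_mul,
      map_add]
    noncomm_ring
  · intro m hm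
    have := y_comm_of_mem hN hm
    rw [pow_two, mul_assoc, this, ← mul_assoc, this, mul_assoc]
  · rintro _ (rfl | rfl | hm)
    · exact gen_mem_skewPolys
    · exact coeff_mem_skewPolys hyM
    · exact coeff_mem_skewPolys (hNM _ hm)
  · rw [pow_two, ← mul_assoc q, Q.mul_y e q, mul_assoc _ (Q.K q), Q.mul_y e (Q.K q), hK, mul_assoc]

/-- The commutator of H and F yields only K = K⁻¹ on invariants. An element fixed by K² lies in
N(y_e), which is commutative, and commuting with y_e means being fixed by K. -/
theorem K_eq_of_K_K_eq (hN : ∀ m ∈ N, ∀ a : D, m * a = a * m)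
    (hc : ∀ c : ℂ, algebraMap ℂ D c ∈ N) (hh : h ≠ 0) {q : D} (hq : q ∈ Q.planeField e N)
    (hK : Q.K (Q.K q) = q) : Q.K q = q := by
  have h1 := y_comm_of_mem hN (mem_of_K_K_eq hN hc hh hq hK)
  rw [mul_y] at h1
  exact (mul_left_cancel₀ (Q.ι_y_ne_zero e) h1).symm

theorem mem_constants_of_commute_slope (hN : ∀ m ∈ N, ∀ a : D, m * a = a * m)
    (hc : ∀ c : ℂ, algebraMap ℂ D c ∈ N) (hh : h ≠ 0) {q : D} (hq : q ∈ Q.planeField e N)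
    (hK : Q.K (Q.K q) = q) (hz : Q.slope e * q = q * Q.slope e) : q ∈ N :=
  mem_constants_of_commute hN hc hh (Q.ι_y_ne_zero e) (Q.slope_y e)
    (mem_of_K_K_eq hN hc hh hq hK) hz

theorem mem_constants_of_central (hN : ∀ m ∈ N, ∀ a : D, m * a = a * m)
    (hc : ∀ c : ℂ, algebraMap ℂ D c ∈ N) (hh : h ≠ 0) {q : D} (hq : q ∈ Q.planeField e N)
    (hcen : ∀ l ∈ Q.planeField e N, l * q = q * l) : q ∈ N := by
  have h1 := hcen _ y_mem_planeField
  rw [mul_y] at h1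
  have h2 := (mul_left_cancel₀ (Q.ι_y_ne_zero e) h1).symm
  exact mem_constants_of_commute_slope hN hc hh hq (by rw [h2, h2]) (hcen _ slope_mem_planeField)

/-- From F q = H q = 0 the relation for [H, F] gives K² q = q, hence K q = q and Hsym q = 0. Then
`x_mul` and `mul_y` say that q commutes with x_e and y_e, so with the slope. -/
theorem mem_constants_of_invariant (hN : ∀ m ∈ N, ∀ a : D, m * a = a * m)
    (hc : ∀ c : ℂ, algebraMap ℂ D c ∈ N) (hh : h ≠ 0) {q : D} (hq : q ∈ Q.planeField e N)
    (hF : Q.F q = 0) (hH : Q.H q = 0) : q ∈ N := by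
  have h1 := Q.H_F q
  rw [hF, hH, map_zero, map_zero, sub_zero, smul_zero, eq_comm, sub_eq_zero,
    AlgEquiv.symm_apply_eq] at h1
  have h2 := K_eq_of_K_K_eq hN hc hh hq h1.symm
  have h3 : Q.Hsym q = 0 := by simp [Hsym_apply, h2, hH]
  have h4 := Q.x_mul e q
  rw [h2, h3, mul_zero, smul_zero, sub_zero] at h4
  have h5 := Q.mul_y e q
  rw [h2] at h5
  refine mem_constants_of_commute_slope hN hc hh hq h1.symm ?_
  have h6 : (Q.ι (HAlg.y e))⁻¹ * q = q * (Q.ι (HAlg.y e))⁻¹ := by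
    rw [inv_mul_eq_iff_eq_mul₀ (Q.ι_y_ne_zero e), ← mul_assoc, ← h5,
      mul_inv_cancel_right₀ (Q.ι_y_ne_zero e)]
  rw [slope, mul_assoc, h6, ← mul_assoc, h4, mul_assoc]

/-- Up to the central ratios and brackets, all pairs of generators are expressed through the single
pair (x_e, y_e). -/
theorem ι_mem_planeField (hc : ∀ c : ℂ, algebraMap ℂ D c ∈ N)
    (hr : ∀ j, j ≠ o → (Q.ratio e j : D) ∈ N) (hb : ∀ j, j ≠ o → (Q.brac e j : D) ∈ N)
    {a : HAlg h I} (ha : a ∈ HAlg.sub h ({o}ᶜ : Set I)) : Q.ι a ∈ Q.planeField e N := by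
  have hxe : Q.ι (HAlg.x e) ∈ Q.planeField e N := by
    rw [← slope_mul]; exact mul_mem slope_mem_planeField y_mem_planeField
  induction ha using Algebra.adjoin_induction with
  | mem a ha =>
    rcases ha with ⟨j, hj, rfl⟩ | ⟨j, hj, rfl⟩
    · rw [x_eq Q e j]
      exact add_mem (mul_mem hxe (const_mem_planeField (hr j hj)))
        (mul_mem (inv_mem y_mem_planeField) (const_mem_planeField (hb j hj)))
    · rw [y_eq Q e j]
      exact mul_mem y_mem_planeField (const_mem_planeField (hr j hj))
  | algebraMap c => rw [AlgHom.commutes]; exact const_mem_planeField (hc c)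
  | add a b _ _ ha hb => rw [map_add]; exact add_mem ha hb
  | mul a b _ _ ha hb => rw [map_mul]; exact mul_mem ha hb

end PlaneField

end SkewExt

-- Independence over the ring F[S] passes to its fraction field F(S).
open IntermediateField.algebraAdjoinAdjoin in
theorem AlgebraicIndependent.intermediateFieldAdjoin {F E ι : Type*} [Field F] [Field E]
    [Algebra F E] {S : Set E} {v : ι → E} (hv : AlgebraicIndependent (Algebra.adjoin F S) v) :
    AlgebraicIndependent (IntermediateField.adjoin F S) v :=
  hv.extendScalars _

theorem AlgebraicIndependent.linearIndependent_mul_pow {R A : Type*} [CommRing R] [CommRing A]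
    [Algebra R A] {v : Bool → A} (hv : AlgebraicIndependent R v) :
    LinearIndependent R (fun i : ℕ × ℕ => v false ^ i.1 * v true ^ i.2) := by
  have h1 := (MvPolynomial.basisMonomials Bool R).linearIndependent.map'
    (MvPolynomial.aeval (R := R) v).toLinearMap (LinearMap.ker_eq_bot.2 hv)
  have h2 := h1.comp (fun i : ℕ × ℕ => Finsupp.single false i.1 + Finsupp.single true i.2) ?_
  · have h3 : (fun i : ℕ × ℕ => v false ^ i.1 * v true ^ i.2) =
        (⇑(MvPolynomial.aeval v).toLinearMap ∘ ⇑(MvPolynomial.basisMonomials Bool R)) ∘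
          fun i => Finsupp.single false i.1 + Finsupp.single true i.2 := by
      funext i
      simp [MvPolynomial.aeval_monomial, Finsupp.prod_fintype]
      ring
    rw [h3]
    exact h2
  · rintro ⟨a, b⟩ ⟨c, d⟩ hab
    have h3 := DFunLike.congr_fun hab false
    have h4 := DFunLike.congr_fun hab true
    simp at h3 h4
    rw [h3, h4]

/-! ### Algebraic constants and independence over the coefficients -/

namespace SkewExt

variable {h : ℂ} {I : Type*} [LinearOrder I] {o : I} {D : Type*} [DivisionRing D] [Algebra ℂ D]
  (Q : SkewExt (h := h) o D)

/-- The field generated by the central elements `y_j y_e⁻¹`, `x_j y_e - y_j x_e - h y_j y_e` with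
`j ≠ o`. -/
noncomputable def baseField (e : I) : IntermediateField ℂ (Subring.center D) :=
  IntermediateField.adjoin ℂ (Q.centralFamily e '' {i | (i.1 : I) ≠ o})

/-- The algebraic closure of `Q.baseField e` in the centre. -/
noncomputable def algField (e : I) : IntermediateField (Q.baseField e) (Subring.center D) :=
  algebraicClosure (Q.baseField e) (Subring.center D)

/-- The constants as elements of `D`. -/
noncomputable def baseConst (e : I) : Subfield D :=
  (Q.baseField e).toSubfield.map (Subring.center D).subtype

/-- The algebraic constants as elements of `D`. -/
noncomputable def algConst (e : I) : Subfield D :=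
  (Q.algField e).toSubfield.map (Subring.center D).subtype

variable {Q} {e : I}

theorem mem_baseConst {a : D} : a ∈ Q.baseConst e ↔ ∃ c ∈ Q.baseField e, (c : D) = a := Iff.rfl

theorem mem_algConst {a : D} : a ∈ Q.algConst e ↔ ∃ c ∈ Q.algField e, (c : D) = a := Iff.rfl

theorem baseConst_le : Q.baseConst e ≤ Q.algConst e := by
  intro a ha
  obtain ⟨c, hc, rfl⟩ := mem_baseConst.1 ha
  exact mem_algConst.2 ⟨c, (Q.algField e).algebraMap_mem ⟨c, hc⟩, rfl⟩

theorem algConst_central {m : D} (hm : m ∈ Q.algConst e) (a : D) : m * a = a * m := by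
  obtain ⟨c, _, rfl⟩ := mem_algConst.1 hm
  exact (Subring.mem_center_iff.1 c.2 a).symm

theorem algebraMap_mem_baseConst (c : ℂ) : algebraMap ℂ D c ∈ Q.baseConst e :=
  mem_baseConst.2 ⟨algebraMap ℂ _ c, (Q.baseField e).algebraMap_mem c, rfl⟩

theorem ratio_mem_baseConst {j : I} (hj : j ≠ o) : (Q.ratio e j : D) ∈ Q.baseConst e := by
  by_cases hje : j = e
  · subst hje
    have : (Q.ratio j j : D) = 1 := mul_inv_cancel₀ (Q.ι_y_ne_zero j)
    rw [this]
    exact one_mem _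
  · exact mem_baseConst.2 ⟨_, IntermediateField.subset_adjoin ℂ _
      ⟨(⟨j, hje⟩, false), hj, rfl⟩, by simp [centralFamily]⟩

theorem brac_mem_baseConst {j : I} (hj : j ≠ o) : (Q.brac e j : D) ∈ Q.baseConst e := by
  by_cases hje : j = e
  · subst hje
    have : (Q.brac j j : D) = 0 := by
      rw [brac_eq, HAlg.xy_self]; simp
    rw [this]
    exact zero_mem _
  · exact mem_baseConst.2 ⟨_, IntermediateField.subset_adjoin ℂ _
      ⟨(⟨j, hje⟩, true), hj, rfl⟩, by simp [centralFamily]⟩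

theorem mem_baseConst_of_invariant (hh : h ≠ 0) {q : D}
    (hq : q ∈ Subfield.closure (Q.ι '' (HAlg.sub h {o}ᶜ : Set (HAlg h I))))
    (hF : Q.F q = 0) (hH : Q.H q = 0) : q ∈ Q.baseConst e := by
  refine mem_constants_of_invariant (e := e) (fun m hm => algConst_central (baseConst_le hm))
    algebraMap_mem_baseConst hh ?_ hF hH
  refine (Subfield.closure_le.2 ?_) hq
  rintro _ ⟨a, ha, rfl⟩
  exact ι_mem_planeField algebraMap_mem_baseConst (fun j => ratio_mem_baseConst)
    (fun j => brac_mem_baseConst) ha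

/-- The polynomial witnessing that an element of Σ is algebraic has invariant coefficients; these
are base constants, so the polynomial descends to the base field. -/
theorem sig_le_algConst (hh : h ≠ 0) : Q.Sig ≤ Q.algConst e := by
  intro s hs
  obtain ⟨p, hp0, hps, hp⟩ := Q.Sig_algebraic s hs
  refine mem_algConst.2 ⟨⟨s, Subring.mem_center_iff.2 fun a => (Q.Sig_central s hs a).symm⟩, ?_,
    rfl⟩
  rw [algField, mem_algebraicClosure_iff]
  set f : Q.baseField e →+* D :=
    (Subring.center D).subtype.comp (algebraMap (Q.baseField e) (Subring.center D)) with hf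
  have hlift : p ∈ Polynomial.lifts f := by
    rw [Polynomial.lifts_iff_coeff_lifts]
    intro k
    obtain ⟨h1, _, h3, h4⟩ := hp k
    obtain ⟨c, hc, hcp⟩ := mem_baseConst.1 (mem_baseConst_of_invariant (e := e) hh h1 h3 h4)
    exact ⟨⟨c, hc⟩, hcp⟩
  obtain ⟨P, rfl⟩ := (Polynomial.mem_lifts _).1 hlift
  refine ⟨P, fun h0 => hp0 (by rw [h0, Polynomial.map_zero]), ?_⟩
  apply Subtype.ext
  rw [Polynomial.eval_map] at hps
  rw [Polynomial.aeval_def]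
  have := Polynomial.hom_eval₂ P (algebraMap (Q.baseField e) (Subring.center D))
    (Subring.center D).subtype ⟨s, Subring.mem_center_iff.2 fun a => (Q.Sig_central s hs a).symm⟩
  exact this.trans hps

theorem coeffs_le_planeField (hh : h ≠ 0) : Q.coeffs ≤ Q.planeField e (Q.algConst e) := by
  refine Subfield.closure_le.2 ?_
  rintro _ (⟨a, ha, rfl⟩ | hs)
  · exact ι_mem_planeField (fun c => baseConst_le (algebraMap_mem_baseConst c))
      (fun j hj => baseConst_le (ratio_mem_baseConst hj))
      (fun j hj => baseConst_le (brac_mem_baseConst hj)) ha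
  · exact const_mem_planeField (sig_le_algConst hh hs)

/-- The independent family is split into indices different from o, which generate the base field,
and the two elements attached to o. The latter stay independent after passing to fractions and then
to the algebraic closure. -/
theorem linearIndependent_algField (hoe : o ≠ e) :
    LinearIndependent (Q.algField e)
      (fun i : ℕ × ℕ => Q.ratio e o ^ i.1 * Q.brac e o ^ i.2) := by
  have h1 := (Q.algebraicIndependent_centralFamily e).adjoin_of_disjoint
    (s := {i | (i.1 : I) ≠ o}) (t := {i | (i.1 : I) = o})
    (Set.disjoint_left.2 fun i hi hi' => hi hi')
  have h2 : AlgebraicIndependent (Q.algField e) _ := h1.intermediateFieldAdjoin.algebraicClosure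
  have h3 := h2.comp (fun b : Bool => ⟨(⟨o, hoe⟩, b), rfl⟩) fun a b hab => by simpa using hab
  exact h3.linearIndependent_mul_pow

/-- The monomials in the two central elements attached to `x_o`, `y_o` are linearly independent
over the coefficients. -/
theorem eq_zero_of_sum_monomials (hh : h ≠ 0) (hoe : o ≠ e) (s : Finset (ℕ × ℕ))
    (l : ℕ × ℕ → D) (hl : ∀ i, l i ∈ Q.coeffs)
    (h0 : ∑ i ∈ s, l i * ((Q.ratio e o : D) ^ i.1 * (Q.brac e o : D) ^ i.2) = 0) :
    ∀ i ∈ s, l i = 0 := by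
  refine eq_zero_of_sum_mul_central (L := Q.planeField e (Q.algConst e)) (N := Q.algConst e)
    (t := fun i : ℕ × ℕ => Q.ratio e o ^ i.1 * Q.brac e o ^ i.2) ?_ ?_ s l
    (fun i => coeffs_le_planeField hh (hl i)) ?_
  · exact fun q hq hcen => mem_constants_of_central (fun m hm => algConst_central hm)
      (fun c => baseConst_le (algebraMap_mem_baseConst c)) hh hq hcen
  · intro s l hl hsum
    choose c hc hcl using fun i => mem_algConst.1 (hl i)
    have h1 := linearIndependent_iff'.1 (linearIndependent_algField (Q := Q) hoe) s
      (fun i => ⟨c i, hc i⟩) (by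
        apply Subtype.ext
        rw [Subring.coe_zero, ← hsum, AddSubmonoidClass.coe_finsetSum]
        refine Finset.sum_congr rfl fun i _ => ?_
        rw [← hcl i]
        rfl)
    intro i hi
    rw [← hcl i, show c i = 0 from congrArg Subtype.val (h1 i hi)]
    rfl
  · simpa using h0

end SkewExt

namespace SkewExt

variable {h : ℂ} {I : Type*} [LinearOrder I] {o : I} {D : Type*} [DivisionRing D] [Algebra ℂ D]
  (Q : SkewExt (h := h) o D)

/-! ## Stability of the coefficients -/

theorem algebraMap_mem_coeffs (c : ℂ) : algebraMap ℂ D c ∈ Q.coeffs := by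
  rw [← AlgHom.commutes Q.ι]
  exact Q.ι_mem_coeffs (Subalgebra.algebraMap_mem _ c)

theorem smul_mem_coeffs (c : ℂ) {a : D} (ha : a ∈ Q.coeffs) : c • a ∈ Q.coeffs := by
  rw [Algebra.smul_def]
  exact mul_mem (Q.algebraMap_mem_coeffs c) ha

theorem x_mem_coeffs {j : I} (hj : j ≠ o) : Q.ι (HAlg.x j) ∈ Q.coeffs :=
  Q.ι_mem_coeffs (HAlg.x_mem_sub hj)

theorem y_mem_coeffs {j : I} (hj : j ≠ o) : Q.ι (HAlg.y j) ∈ Q.coeffs :=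
  Q.ι_mem_coeffs (HAlg.y_mem_sub hj)

variable {Q} {e : I}

/-- Because e ≠ o, conjugation by y_e realizes K inside the coefficients. -/
theorem K_mem_coeffs (hoe : o ≠ e) {a : D} (ha : a ∈ Q.coeffs) : Q.K a ∈ Q.coeffs := by
  have h1 : Q.K a = (Q.ι (HAlg.y e))⁻¹ * (a * Q.ι (HAlg.y e)) := by
    rw [mul_y, inv_mul_cancel_left₀ (Q.ι_y_ne_zero e)]
  rw [h1]
  exact mul_mem (inv_mem (Q.y_mem_coeffs hoe.symm)) (mul_mem ha (Q.y_mem_coeffs hoe.symm))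

theorem K_symm_mem_coeffs (hoe : o ≠ e) {a : D} (ha : a ∈ Q.coeffs) :
    Q.K.symm a ∈ Q.coeffs := by
  have h1 : Q.K.symm a = Q.ι (HAlg.y e) * a * (Q.ι (HAlg.y e))⁻¹ := by
    rw [y_mul, mul_inv_cancel_right₀ (Q.ι_y_ne_zero e)]
  rw [h1]
  exact mul_mem (mul_mem (Q.y_mem_coeffs hoe.symm) ha) (inv_mem (Q.y_mem_coeffs hoe.symm))

theorem skewDer_mem_coeffs {T : D →ₗ[ℂ] D} {α β : D →ₐ[ℂ] D}
    (hT : ∀ a b, T (a * b) = T a * β b + α a * T b)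
    (hα : ∀ a ∈ Q.coeffs, α a ∈ Q.coeffs) (hβ : ∀ a ∈ Q.coeffs, β a ∈ Q.coeffs)
    (hx : ∀ j, j ≠ o → T (Q.ι (HAlg.x j)) ∈ Q.coeffs)
    (hy : ∀ j, j ≠ o → T (Q.ι (HAlg.y j)) ∈ Q.coeffs)
    (hs : ∀ s ∈ Q.Sig, T s = 0) {a : D} (ha : a ∈ Q.coeffs) : T a ∈ Q.coeffs := by
  refine skewDer_mem hT hα hβ Subfield.subset_closure ?_ ha
  rintro _ (⟨b, hb, rfl⟩ | h)
  · induction hb using Algebra.adjoin_induction with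
    | mem a ha =>
      rcases ha with ⟨j, hj, rfl⟩ | ⟨j, hj, rfl⟩
      · exact hx j hj
      · exact hy j hj
    | algebraMap c =>
      have h1 : T 1 = 0 := skewDer_one (L := ⊤) fun a _ b _ => hT a b
      simp [Algebra.algebraMap_eq_smul_one, h1, zero_mem]
    | add a b _ _ ha hb => rw [map_add, map_add]; exact add_mem ha hb
    | mul a b haS hbS ha hb =>
      rw [map_mul, hT]
      exact add_mem (mul_mem ha (hβ _ (Q.ι_mem_coeffs hbS)))
        (mul_mem (hα _ (Q.ι_mem_coeffs haS)) hb)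
  · rw [hs _ h]; exact zero_mem _

theorem F_mem_coeffs {a : D} (ha : a ∈ Q.coeffs) : Q.F a ∈ Q.coeffs :=
  skewDer_mem_coeffs (α := AlgHom.id ℂ D) (β := AlgHom.id ℂ D) Q.F_mul (fun _ h => h)
    (fun _ h => h) (fun j hj => by rw [F_x]; exact Q.y_mem_coeffs hj)
    (fun j _ => by rw [F_y]; exact zero_mem _) (fun _ hs => Q.F_sig hs) ha

theorem E_mem_coeffs (hoe : o ≠ e) {a : D} (ha : a ∈ Q.coeffs) : Q.E a ∈ Q.coeffs :=
  skewDer_mem_coeffs (α := Q.K) (β := Q.K.symm) Q.E_mul (fun _ h => K_mem_coeffs hoe h)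
    (fun _ h => K_symm_mem_coeffs hoe h)
    (fun j _ => by rw [E_x]; exact zero_mem _)
    (fun j hj => by rw [E_y]; exact Q.x_mem_coeffs hj)
    (fun s hs => (Q.Sig_invariant s hs).2.1) ha

theorem H_mem_coeffs (hoe : o ≠ e) {a : D} (ha : a ∈ Q.coeffs) : Q.H a ∈ Q.coeffs :=
  skewDer_mem_coeffs (α := Q.K) (β := Q.K.symm) Q.H_mul (fun _ h => K_mem_coeffs hoe h)
    (fun _ h => K_symm_mem_coeffs hoe h)
    (fun j hj => by rw [H_x]; exact Q.x_mem_coeffs hj)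
    (fun j hj => by rw [H_y]; exact neg_mem (Q.y_mem_coeffs hj)) (fun _ hs => Q.H_sig hs) ha

theorem Hsym_mem_coeffs (hoe : o ≠ e) {a : D} (ha : a ∈ Q.coeffs) : Q.Hsym a ∈ Q.coeffs :=
  Q.smul_mem_coeffs _ (add_mem (H_mem_coeffs hoe (K_mem_coeffs hoe ha))
    (K_mem_coeffs hoe (H_mem_coeffs hoe ha)))

/-! ## Linear forms -/

/-- `x_o` and `y_o` are linearly independent over the coefficients. -/
theorem eq_zero_of_x_mul_add_y_mul (hh : h ≠ 0) (hoe : o ≠ e) {p q : D} (hp : p ∈ Q.coeffs)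
    (hq : q ∈ Q.coeffs) (h0 : Q.ι (HAlg.x o) * p + Q.ι (HAlg.y o) * q = 0) : p = 0 ∧ q = 0 := by
  have hye := Q.ι_y_ne_zero e
  -- Substituting x_o = x_e u + y_e⁻¹ c and y_o = y_e u, these are the coefficients of u, at (1, 0),
  -- and of c, at (0, 1).
  set l : ℕ × ℕ → D := fun i => if i = (1, 0) then Q.ι (HAlg.x e) * p + Q.ι (HAlg.y e) * q else
    (Q.ι (HAlg.y e))⁻¹ * p with hl
  have hxc := Q.x_mem_coeffs hoe.symm
  have hyc := Q.y_mem_coeffs hoe.symm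
  have key := eq_zero_of_sum_monomials (Q := Q) hh hoe {(1, 0), (0, 1)} l ?_ ?_
  · have h1 := key (0, 1) (by simp)
    have h2 := key (1, 0) (by simp)
    simp only [hl, Prod.mk.injEq, zero_ne_one, one_ne_zero, and_self, if_false, if_true] at h1 h2
    have hp0 := (mul_eq_zero.1 h1).resolve_left (inv_ne_zero hye)
    rw [hp0, mul_zero, zero_add] at h2
    exact ⟨hp0, (mul_eq_zero.1 h2).resolve_left hye⟩
  · intro i
    simp only [hl]
    split_ifs
    · exact add_mem (mul_mem hxc hp) (mul_mem hyc hq)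
    · exact mul_mem (inv_mem hyc) hp
  · rw [Finset.sum_pair (by simp), ← h0, x_eq Q e o, y_eq Q e o]
    have hu := fun a => Subring.mem_center_iff.1 (Q.ratio e o).2 a
    have hb := fun a => Subring.mem_center_iff.1 (Q.brac e o).2 a
    simp only [hl, Prod.mk.injEq, zero_ne_one, one_ne_zero, and_self, if_false, if_true, pow_one,
      pow_zero, mul_one, one_mul, add_mul]
    rw [mul_assoc _ (Q.ratio e o : D) p, ← hu p, mul_assoc _ (Q.brac e o : D) p, ← hb p,
      mul_assoc _ (Q.ratio e o : D) q, ← hu q]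
    simp only [mul_assoc]
    abel

/-- Each of F, E, H applied to the form gives an expression x_o p + y_o q equal to zero, and p = q =
0 by independence. -/
theorem IsLinearForm.relations (hh : h ≠ 0) (hoe : o ≠ e) {X Y : D} (hL : Q.IsLinearForm X Y) :
    Q.F Y = 0 ∧ Q.F X = Y ∧ Q.E X = 0 ∧ Q.E Y = Q.K.symm X + h • Q.K.symm Y ∧
      Q.H Y = - Q.K.symm Y ∧ Q.H X = Q.K.symm X + h • Q.K.symm Y := by
  obtain ⟨hX, hY, _, hE, hF, hH⟩ := hL
  have hKX := K_symm_mem_coeffs hoe hX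
  have hKY := K_symm_mem_coeffs hoe hY
  obtain ⟨f1, f2⟩ := eq_zero_of_x_mul_add_y_mul (Q := Q) hh hoe (p := Q.F Y)
    (q := Y - Q.F X - h • Q.F Y) (F_mem_coeffs hY)
    (sub_mem (sub_mem hY (F_mem_coeffs hX)) (Q.smul_mem_coeffs h (F_mem_coeffs hY))) (by
      rw [← hF]
      simp only [lin, map_sub, map_smul, Q.F_mul, F_x, F_y, mul_sub, mul_smul_comm, zero_mul]
      module)
  obtain ⟨e1, e2⟩ := eq_zero_of_x_mul_add_y_mul (Q := Q) hh hoe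
    (p := Q.E Y - Q.K.symm X - h • Q.K.symm Y) (q := - Q.E X)
    (sub_mem (sub_mem (E_mem_coeffs hoe hY) hKX) (Q.smul_mem_coeffs h hKY))
    (neg_mem (E_mem_coeffs hoe hX)) (by
      rw [← hE]
      simp only [lin, map_sub, map_smul, Q.E_mul, E_x, E_y, K_x, K_y, mul_sub, mul_smul_comm,
        zero_mul, add_mul, smul_mul_assoc, mul_neg]
      module)
  obtain ⟨h1, h2⟩ := eq_zero_of_x_mul_add_y_mul (Q := Q) hh hoe
    (p := Q.K.symm Y + Q.H Y) (q := Q.K.symm X - Q.H X + h • Q.K.symm Y)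
    (add_mem hKY (H_mem_coeffs hoe hY))
    (add_mem (sub_mem hKX (H_mem_coeffs hoe hX)) (Q.smul_mem_coeffs h hKY)) (by
      rw [← hH]
      simp only [lin, map_sub, map_smul, Q.H_mul, H_x, H_y, K_x, K_y, mul_sub, mul_add,
        mul_smul_comm, add_mul, smul_mul_assoc, neg_mul]
      module)
  rw [f1, smul_zero, sub_zero, sub_eq_zero] at f2
  rw [sub_sub, sub_eq_zero] at e1
  refine ⟨f1, f2.symm, neg_eq_zero.1 e2, e1, (neg_eq_of_add_eq_zero_right h1).symm, ?_⟩
  rw [sub_add_eq_add_sub, sub_eq_zero] at h2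
  exact h2.symm

/-- Invariance says nothing directly about K. It is recovered from the commutator of H and F, first
on Y and then on X, through fixed points of K². -/
theorem IsLinearForm.K_eq (hh : h ≠ 0) (hoe : o ≠ e) {X Y : D} (hL : Q.IsLinearForm X Y) :
    Q.K Y = Y ∧ Q.K X = X + h • Y := by
  obtain ⟨fY, fX, -, -, hY, hX⟩ := hL.relations hh hoe
  have hN : ∀ m ∈ Q.algConst e, ∀ a : D, m * a = a * m := fun m hm => algConst_central hm
  have hc : ∀ c : ℂ, algebraMap ℂ D c ∈ Q.algConst e :=
    fun c => baseConst_le (algebraMap_mem_baseConst c)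
  have h1 := Q.H_F Y
  rw [fY, hY, map_zero, map_neg, F_K_symm, fY, map_zero, neg_zero, sub_zero, smul_zero, eq_comm,
    sub_eq_zero, AlgEquiv.symm_apply_eq] at h1
  have hKY : Q.K Y = Y := K_eq_of_K_K_eq hN hc hh (coeffs_le_planeField hh hL.2.1) h1.symm
  have hKY' : Q.K.symm Y = Y := by rw [AlgEquiv.symm_apply_eq, hKY]
  have h2 := Q.H_F X
  rw [fX, hX, hY, map_add, map_smul, F_K_symm, F_K_symm, fX, fY, map_zero, smul_zero, add_zero,
    hKY'] at h2
  have h3 : Q.K (Q.K X) = X + (2 * h) • Y := by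
    have h4 : Q.K X = Q.K.symm X + (2 * h) • Y := by
      rw [← sub_eq_iff_eq_add', ← neg_sub, ← h2]
      module
    rw [h4, map_add, AlgEquiv.apply_symm_apply, map_smul, hKY]
  -- K² adds 2h Y to X, and K adds h to the slope, so subtracting slope times Y makes the element
  -- fixed by K².
  have h5 : Q.K (X - Q.slope e * Y) = X - Q.slope e * Y := by
    refine K_eq_of_K_K_eq hN hc hh (e := e) (sub_mem (coeffs_le_planeField hh hL.1)
      (mul_mem slope_mem_planeField (coeffs_le_planeField hh hL.2.1))) ?_
    simp only [map_sub, map_mul, map_add, map_smul, K_slope, hKY, h3, add_mul,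
      ← Algebra.smul_def]
    module
  refine ⟨hKY, ?_⟩
  rw [map_sub, map_mul, K_slope, hKY, add_mul, ← Algebra.smul_def, sub_eq_iff_eq_add] at h5
  rw [h5]
  abel

theorem IsLinearForm.Hsym_eq (hh : h ≠ 0) (hoe : o ≠ e) {X Y : D} (hL : Q.IsLinearForm X Y) :
    Q.Hsym Y = - Y ∧ Q.Hsym X = X := by
  obtain ⟨-, -, -, -, hY, hX⟩ := hL.relations hh hoe
  obtain ⟨kY, kX⟩ := hL.K_eq hh hoe
  have kY' : Q.K.symm Y = Y := by rw [AlgEquiv.symm_apply_eq, kY]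
  have kX' : Q.K.symm X = X - h • Y := by
    rw [AlgEquiv.symm_apply_eq, map_sub, map_smul, kX, kY, add_sub_cancel_right]
  rw [kY'] at hY
  rw [kX', kY', sub_add_cancel] at hX
  constructor
  · rw [Hsym_apply, kY, hY, map_neg, kY]; module
  · rw [Hsym_apply, kX, map_add, map_smul, hX, hY, kX]; module

theorem IsLinearForm.ne_zero (hh : h ≠ 0) (hoe : o ≠ e) {X Y : D} (hL : Q.IsLinearForm X Y) :
    Y ≠ 0 := by
  rintro rfl
  obtain ⟨-, -, -, hE, -, -⟩ := hL.relations hh hoe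
  rw [map_zero, map_zero, smul_zero, add_zero, eq_comm, map_eq_zero_iff _ Q.K.symm.injective] at hE
  exact hL.2.2.1 (by simp [lin, hE])

/-- Testing on l = x_j and l = y_j, the required relations become the known commutation of x_j and
y_j with X and Y. The values of K and Hsym on X and Y agree with those on generators, so the
relations are symmetric in the two pairs. -/
theorem IsLinearForm.pointOn (hh : h ≠ 0) (hoe : o ≠ e) {X Y : D} (hL : Q.IsLinearForm X Y) :
    Q.PointOn Q.coeffs X Y := by
  obtain ⟨kY, kX⟩ := hL.K_eq hh hoe
  obtain ⟨hY, hX⟩ := hL.Hsym_eq hh hoe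
  have kY' : Q.K.symm Y = Y := by rw [AlgEquiv.symm_apply_eq, kY]
  have hYl : ∀ l ∈ Q.coeffs, Y * l = Q.K.symm l * Y := by
    intro l hl
    have := Q.skewDer_eq_zero_of_coeffs (T := LinearMap.mulLeft ℂ Y
        - LinearMap.mulRight ℂ Y ∘ₗ Q.K.symm.toLinearMap)
      (α := Q.K.symm) (β := AlgHom.id ℂ D) ?_ ?_ ?_ ?_ hl
    · simpa [sub_eq_zero] using this
    · intro a _ b _
      simp only [LinearMap.sub_apply, LinearMap.comp_apply, LinearMap.mulLeft_apply,
        LinearMap.mulRight_apply, AlgEquiv.toLinearMap_apply, map_mul, AlgHom.id_apply,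
        AlgEquiv.coe_toAlgHom]
      noncomm_ring
    · intro j _
      have h1 := Q.x_mul j Y
      rw [kY, hY] at h1
      simp only [LinearMap.sub_apply, LinearMap.comp_apply, LinearMap.mulLeft_apply,
        LinearMap.mulRight_apply, AlgEquiv.toLinearMap_apply, K_symm_x, sub_mul, h1,
        smul_mul_assoc, mul_neg, smul_neg]
      abel
    · intro j _
      simp [K_symm_y, Q.y_mul j Y, kY']
    · intro s hs
      simp [K_symm_sig Q hs, Q.Sig_central s hs]
  have hYl' : ∀ l ∈ Q.coeffs, l * Y = Y * Q.K l := fun l hl => by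
    rw [hYl _ (K_mem_coeffs hoe hl), AlgEquiv.symm_apply_apply]
  refine ⟨hYl, fun l hl => ?_⟩
  have := Q.skewDer_eq_zero_of_coeffs (T := LinearMap.mulLeft ℂ X
      - LinearMap.mulRight ℂ X ∘ₗ Q.K.toLinearMap + h • (LinearMap.mulLeft ℂ Y ∘ₗ Q.Hsym))
    (α := Q.K) (β := AlgHom.id ℂ D) ?_ ?_ ?_ ?_ hl
  · simp only [LinearMap.sub_apply, LinearMap.add_apply, LinearMap.smul_apply,
      LinearMap.comp_apply, LinearMap.mulLeft_apply,
      LinearMap.mulRight_apply, AlgEquiv.toLinearMap_apply] at this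
    rw [← sub_eq_zero, ← this]
    abel
  · intro a ha b _
    simp only [LinearMap.sub_apply, LinearMap.add_apply, LinearMap.smul_apply,
      LinearMap.comp_apply, LinearMap.mulLeft_apply,
      LinearMap.mulRight_apply, AlgEquiv.toLinearMap_apply, map_mul, AlgHom.id_apply,
      AlgEquiv.coe_toAlgHom, Hsym_mul, mul_add, add_mul, sub_mul, mul_sub, smul_add,
      smul_mul_assoc, mul_smul_comm, ← mul_assoc, hYl' _ (K_mem_coeffs hoe ha)]
    abel
  · intro j _
    have h1 := Q.x_mul j X
    have h2 := Q.y_mul j X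
    have kX' : Q.K.symm X = X - h • Y := by
      rw [AlgEquiv.symm_apply_eq, map_sub, map_smul, kX, kY, add_sub_cancel_right]
    rw [kX, hX, add_mul, smul_mul_assoc, h2, kX'] at h1
    simp only [LinearMap.sub_apply, LinearMap.add_apply, LinearMap.smul_apply,
      LinearMap.comp_apply, LinearMap.mulLeft_apply,
      LinearMap.mulRight_apply, AlgEquiv.toLinearMap_apply, K_x, Hsym_x, add_mul, smul_mul_assoc,
      h1, h2, kX']
    module
  · intro j _
    have h2 := Q.y_mul j X
    have kX' : Q.K.symm X = X - h • Y := by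
      rw [AlgEquiv.symm_apply_eq, map_sub, map_smul, kX, kY, add_sub_cancel_right]
    simp only [LinearMap.sub_apply, LinearMap.add_apply, LinearMap.smul_apply,
      LinearMap.comp_apply, LinearMap.mulLeft_apply,
      LinearMap.mulRight_apply, AlgEquiv.toLinearMap_apply, K_y, Hsym_y, mul_neg, h2, kX', sub_mul,
      smul_mul_assoc]
    module
  · intro s hs
    simp [K_sig Q hs, Hsym_sig Q hs, Q.Sig_central s hs]

end SkewExt

namespace SkewExt

variable {h : ℂ} {I : Type*} [LinearOrder I] {o : I} {D : Type*} [DivisionRing D] [Algebra ℂ D]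
  {Q : SkewExt (h := h) o D} {e : I}

/-! ## Polarization operators -/

theorem coeffs_subset_polys {a : D} (ha : a ∈ Q.coeffs) : a ∈ Q.polys :=
  Algebra.subset_adjoin (Or.inr ha)

theorem ι_mem_polys (a : HAlg h I) : Q.ι a ∈ Q.polys := Algebra.subset_adjoin (Or.inl ⟨a, rfl⟩)

theorem polys_induction {P : Q.polys → Prop} (hx : P (Q.toPolys (HAlg.x o)))
    (hy : P (Q.toPolys (HAlg.y o))) (hc : ∀ a : Q.polys, (a : D) ∈ Q.coeffs → P a)
    (hadd : ∀ a b, P a → P b → P (a + b)) (hmul : ∀ a b, P a → P b → P (a * b)) (a : Q.polys) :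
    P a := by
  have halg : ∀ c : ℂ, P (algebraMap ℂ Q.polys c) := fun c => hc _ (Q.algebraMap_mem_coeffs c)
  have hι : ∀ b : HAlg h I, P (Q.toPolys b) := by
    intro b
    induction b using HAlg.induction with
    | hc c =>
      convert halg c
      exact Subtype.ext (Q.ι.commutes c)
    | hx i =>
      by_cases hi : i = o
      · exact hi ▸ hx
      · exact hc _ (Q.x_mem_coeffs hi)
    | hy i =>
      by_cases hi : i = o
      · exact hi ▸ hy
      · exact hc _ (Q.y_mem_coeffs hi)
    | hadd a b ha hb =>
      convert hadd _ _ ha hb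
      exact Subtype.ext (map_add Q.ι a b)
    | hmul a b ha hb =>
      convert hmul _ _ ha hb
      exact Subtype.ext (map_mul Q.ι a b)
  obtain ⟨a, ha⟩ := a
  induction ha using Algebra.adjoin_induction with
  | mem a ha =>
    rcases ha with ⟨b, rfl⟩ | ha
    · exact hι b
    · exact hc _ ha
  | algebraMap c => exact halg c
  | add a b _ _ ha hb => exact hadd _ _ ha hb
  | mul a b _ _ ha hb => exact hmul _ _ ha hb

theorem IsPolarization.unique {X Y : D} {Δ Δ' : Q.polys →ₗ[ℂ] Q.polys}
    (hΔ : Q.IsPolarization X Y Δ) (hΔ' : Q.IsPolarization X Y Δ') : Δ = Δ' := by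
  obtain ⟨h1, h2, h3, h4⟩ := hΔ
  obtain ⟨h1', h2', h3', h4'⟩ := hΔ'
  ext1 a
  induction a using polys_induction with
  | hx => exact Subtype.ext (h2.trans h2'.symm)
  | hy => exact Subtype.ext (h3.trans h3'.symm)
  | hc a ha => rw [h4 a ha, h4' a ha]
  | hadd a b ha hb => rw [map_add, map_add, ha, hb]
  | hmul a b ha hb => rw [h1, h1', ha, hb]

/-- The inclusion of the coefficients. -/
noncomputable def coeffsHom (Q : SkewExt (h := h) o D) : Q.coeffs →+* Q.polys where
  toFun a := ⟨a, coeffs_subset_polys a.2⟩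
  map_one' := rfl
  map_mul' _ _ := rfl
  map_zero' := rfl
  map_add' _ _ := rfl

/-- Monomials in two commuting elements. -/
def monomialHom {R : Type*} [Monoid R] (u c : R) (huc : Commute u c) :
    Multiplicative (ℕ × ℕ) →* R where
  toFun i := u ^ i.toAdd.1 * c ^ i.toAdd.2
  map_one' := by simp
  map_mul' i j := by
    simp only [toAdd_mul, Prod.fst_add, Prod.snd_add, pow_add]
    rw [mul_assoc, mul_assoc, ← mul_assoc (u ^ _) (c ^ _) (c ^ _),
      ← mul_assoc (c ^ _) (u ^ _), (huc.pow_pow _ _).eq]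

/-- The evaluation of polynomials in two commuting variables. -/
noncomputable def evalTwo {L R : Type*} [Ring L] [Ring R] (f : L →+* R) (u c : R)
    (huc : Commute u c) (hu : ∀ l, Commute (f l) u) (hc : ∀ l, Commute (f l) c) :
    AddMonoidAlgebra L (ℕ × ℕ) →+* R :=
  AddMonoidAlgebra.liftNCRingHom f (monomialHom u c huc) fun l _ =>
    ((hu l).pow_right _).mul_right ((hc l).pow_right _)

theorem evalTwo_single {L R : Type*} [Ring L] [Ring R] (f : L →+* R) (u c : R)
    (huc : Commute u c) (hu : ∀ l, Commute (f l) u) (hc : ∀ l, Commute (f l) c) (i : ℕ × ℕ)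
    (l : L) : evalTwo f u c huc hu hc (AddMonoidAlgebra.single i l) =
      f l * (u ^ i.1 * c ^ i.2) := by
  rw [evalTwo]
  exact AddMonoidAlgebra.liftNC_single _ _ _ _

/-- `Q.polys` is the polynomial ring over the coefficients in the central variables u and c:
injectivity is the independence of the monomials, surjectivity the expression of x_o and y_o through
u and c. -/
theorem bijective_evalTwo {f : Q.coeffs →+* Q.polys} (hf : f = Q.coeffsHom) (hh : h ≠ 0)
    (hoe : o ≠ e) {u c : Q.polys} (hu' : (u : D) = Q.ratio e o) (hc' : (c : D) = Q.brac e o)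
    (huc : Commute u c) (hu : ∀ l, Commute (f l) u) (hc : ∀ l, Commute (f l) c) :
    Function.Bijective (evalTwo f u c huc hu hc) := by
  have hsurj : ∀ l, f l ∈ (evalTwo f u c huc hu hc).range := fun l =>
    ⟨AddMonoidAlgebra.single (0, 0) l, by rw [evalTwo_single]; simp⟩
  have hu1 : u ∈ (evalTwo f u c huc hu hc).range :=
    ⟨AddMonoidAlgebra.single (1, 0) 1, by rw [evalTwo_single]; simp⟩
  have hc1 : c ∈ (evalTwo f u c huc hu hc).range :=
    ⟨AddMonoidAlgebra.single (0, 1) 1, by rw [evalTwo_single]; simp⟩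
  constructor
  · rw [injective_iff_map_eq_zero]
    intro p hp
    have h1 : ∑ i ∈ p.coeff.support, (p.coeff i : D) *
        ((Q.ratio e o : D) ^ i.1 * (Q.brac e o : D) ^ i.2) = 0 := by
      rw [← AddMonoidAlgebra.sum_coeff_single p, Finsupp.sum, map_sum] at hp
      have h2 := congrArg (Subtype.val : Q.polys → D) hp
      rw [AddSubmonoidClass.coe_finsetSum] at h2
      rw [← ZeroMemClass.coe_zero Q.polys, ← h2]
      refine Finset.sum_congr rfl fun i _ => ?_
      rw [evalTwo_single, hf, ← hu', ← hc']
      rfl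
    have h3 := eq_zero_of_sum_monomials hh hoe _ (fun i => (p.coeff i : D))
      (fun i => (p.coeff i).2) h1
    ext i
    by_contra hi
    exact hi (h3 i (Finsupp.mem_support_iff.2 fun h0 => hi (by rw [h0]; rfl)))
  · intro a
    change a ∈ (evalTwo f u c huc hu hc).range
    have hxc := Q.x_mem_coeffs hoe.symm
    have hyc := Q.y_mem_coeffs hoe.symm
    induction a using polys_induction with
    | hx =>
      have h1 : Q.toPolys (HAlg.x o) = f ⟨_, hxc⟩ * u + f ⟨_, inv_mem hyc⟩ * c := by
        apply Subtype.ext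
        rw [hf]
        simp only [Subalgebra.coe_add, Subalgebra.coe_mul, hu', hc']
        exact Q.x_eq e o
      rw [h1]
      exact add_mem (mul_mem (hsurj _) hu1) (mul_mem (hsurj _) hc1)
    | hy =>
      have h1 : Q.toPolys (HAlg.y o) = f ⟨_, hyc⟩ * u := by
        apply Subtype.ext
        rw [hf]
        simp only [Subalgebra.coe_mul, hu']
        exact Q.y_eq e o
      rw [h1]
      exact mul_mem (hsurj _) hu1
    | hc a ha =>
      have h1 : a = f ⟨a, ha⟩ := by rw [hf]; rfl
      rw [h1]
      exact hsurj _
    | hadd a b ha hb => exact add_mem ha hb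
    | hmul a b ha hb => exact mul_mem ha hb

theorem fst_evalTwo {L P : Type*} [Ring L] [Ring P] (f : L →+* P) (u c a b : P)
    (huc : Commute u c) (hu : ∀ l, Commute (f l) u) (hc : ∀ l, Commute (f l) c)
    (huc' : Commute (TrivSqZeroExt.inl u + TrivSqZeroExt.inr a : DualNumber P)
      (TrivSqZeroExt.inl c + TrivSqZeroExt.inr b))
    (hu' : ∀ l, Commute ((TrivSqZeroExt.inlHom P P).comp f l) _)
    (hc' : ∀ l, Commute ((TrivSqZeroExt.inlHom P P).comp f l) _) (p : AddMonoidAlgebra L (ℕ × ℕ)) :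
    (evalTwo ((TrivSqZeroExt.inlHom P P).comp f) _ _ huc' hu' hc' p).fst =
      evalTwo f u c huc hu hc p := by
  induction p using AddMonoidAlgebra.induction_linear with
  | zero => simp
  | add p q hp hq => rw [map_add, map_add, TrivSqZeroExt.fst_add, hp, hq]
  | single i l => simp [evalTwo_single]

/-- A derivation over the coefficients may be prescribed on u and c by any values a, b commuting
with the coefficients. The right values are the ratio and bracket with (x_o, y_o) replaced by (X,
Y). The derivation is the ε-part of the ring homomorphism u ↦ u + ε a, c ↦ c + ε b into the dual
numbers. -/
theorem exists_polarization (hh : h ≠ 0) (hoe : o ≠ e) {X Y : D} (hX : X ∈ Q.coeffs)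
    (hY : Y ∈ Q.coeffs) (hP : Q.PointOn Q.coeffs X Y) : ∃ Δ, Q.IsPolarization X Y Δ := by
  have hxc := Q.x_mem_coeffs hoe.symm
  have hyc := Q.y_mem_coeffs hoe.symm
  have hye := Q.ι_y_ne_zero e
  let u : Q.polys := ⟨Q.ratio e o, mul_mem (ι_mem_polys _) (coeffs_subset_polys (inv_mem hyc))⟩
  let c : Q.polys := ⟨Q.brac e o, by rw [brac_eq]; exact ι_mem_polys _⟩
  have huC : ∀ p : Q.polys, Commute p u := fun p =>
    Subtype.ext (Subring.mem_center_iff.1 (Q.ratio e o).2 p)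
  have hcC : ∀ p : Q.polys, Commute p c := fun p =>
    Subtype.ext (Subring.mem_center_iff.1 (Q.brac e o).2 p)
  let a : Q.polys := ⟨Y * (Q.ι (HAlg.y e))⁻¹, coeffs_subset_polys (mul_mem hY (inv_mem hyc))⟩
  let b : Q.polys := ⟨Q.bracket X Y (Q.ι (HAlg.x e)) (Q.ι (HAlg.y e)), coeffs_subset_polys
    (sub_mem (sub_mem (mul_mem hX hyc) (mul_mem hY hxc)) (Q.smul_mem_coeffs h (mul_mem hY hyc)))⟩
  have haC : ∀ l, Commute (Q.coeffsHom l) a := fun l => Subtype.ext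
    (hP.ratio_comm (Q.pointOn_gens _ e) hye (K_mem_coeffs hoe l.2)).symm
  have hbC : ∀ l, Commute (Q.coeffsHom l) b := fun l => Subtype.ext
    (hP.bracket_comm (Q.pointOn_gens _ e) l.2 (K_mem_coeffs hoe l.2) (K_symm_mem_coeffs hoe l.2)
      (Hsym_mem_coeffs hoe l.2)).symm
  let f2 := (TrivSqZeroExt.inlHom Q.polys Q.polys).comp Q.coeffsHom
  let u2 : DualNumber Q.polys := TrivSqZeroExt.inl u + TrivSqZeroExt.inr a
  let c2 : DualNumber Q.polys := TrivSqZeroExt.inl c + TrivSqZeroExt.inr b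
  -- As ε² = 0, the product a b never occurs, and centrality of u and c suffices.
  have huc2 : Commute u2 c2 := by
    refine TrivSqZeroExt.ext ?_ ?_
    · simpa [u2, c2] using (hcC u).eq
    · simp only [u2, c2, TrivSqZeroExt.snd_mul, TrivSqZeroExt.fst_add, TrivSqZeroExt.fst_inl,
        TrivSqZeroExt.fst_inr, add_zero, TrivSqZeroExt.snd_add, TrivSqZeroExt.snd_inl,
        TrivSqZeroExt.snd_inr, zero_add, smul_eq_mul, op_smul_eq_mul]
      rw [(huC b).eq, (hcC a).eq, add_comm]
  have hu2 : ∀ l, Commute (f2 l) u2 := fun l => by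
    refine TrivSqZeroExt.ext ?_ ?_
    · simpa [u2, f2] using (huC _).eq
    · simpa [u2, f2] using (haC l).eq
  have hc2 : ∀ l, Commute (f2 l) c2 := fun l => by
    refine TrivSqZeroExt.ext ?_ ?_
    · simpa [c2, f2] using (hcC _).eq
    · simpa [c2, f2] using (hbC l).eq
  let φ := RingEquiv.ofBijective (evalTwo Q.coeffsHom u c (hcC u) (fun _ => huC _) fun _ => hcC _)
    (bijective_evalTwo rfl hh hoe rfl rfl _ _ _)
  let ψ := evalTwo f2 u2 c2 huc2 hu2 hc2
  have hfst : ∀ p, (ψ (φ.symm p)).fst = p := fun p => by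
    have := fst_evalTwo Q.coeffsHom u c a b (hcC u) (fun _ => huC _) (fun _ => hcC _) huc2 hu2 hc2
      (φ.symm p)
    exact this.trans (φ.apply_symm_apply p)
  have hsingle : ∀ i l, φ.symm (Q.coeffsHom l * (u ^ i.1 * c ^ i.2)) =
      AddMonoidAlgebra.single i l := fun i l => by
    rw [RingEquiv.symm_apply_eq]
    exact (evalTwo_single Q.coeffsHom u c (hcC u) (fun _ => huC _) (fun _ => hcC _) i l).symm
  let δ : Q.polys → Q.polys := fun p => (ψ (φ.symm p)).snd
  have hadd : ∀ p q, δ (p + q) = δ p + δ q := fun p q => by simp [δ]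
  have hmul : ∀ p q, δ (p * q) = δ p * q + p * δ q := fun p q => by
    simp only [δ, map_mul, TrivSqZeroExt.snd_mul, hfst, smul_eq_mul, op_smul_eq_mul]
    rw [add_comm]
  have hψ : ∀ i l, ψ (AddMonoidAlgebra.single i l) = f2 l * (u2 ^ i.1 * c2 ^ i.2) :=
    fun i l => evalTwo_single f2 u2 c2 huc2 hu2 hc2 i l
  have hcoef : ∀ l, δ (Q.coeffsHom l) = 0 := fun l => by
    have h1 := hsingle (0, 0) l
    rw [pow_zero, pow_zero, mul_one, mul_one] at h1
    simp only [δ, h1, hψ]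
    simp [f2]
  have hδu : δ u = a := by
    have h1 := hsingle (1, 0) 1
    rw [pow_one, pow_zero, mul_one, map_one, one_mul] at h1
    simp only [δ, h1, hψ]
    simp [f2, u2]
  have hδc : δ c = b := by
    have h1 := hsingle (0, 1) 1
    rw [pow_one, pow_zero, one_mul, map_one, one_mul] at h1
    simp only [δ, h1, hψ]
    simp [f2, c2]
  have hcoef' : ∀ p : Q.polys, (p : D) ∈ Q.coeffs → δ p = 0 := fun p hp => hcoef ⟨p, hp⟩
  refine ⟨{ toFun := δ, map_add' := hadd, map_smul' := fun k p => ?_ }, hmul, ?_, ?_, hcoef'⟩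
  · rw [Algebra.smul_def, hmul, hcoef' (algebraMap ℂ Q.polys k) (Q.algebraMap_mem_coeffs k),
      zero_mul, zero_add, RingHom.id_apply, Algebra.smul_def]
  · have h1 : Q.toPolys (HAlg.x o) =
        Q.coeffsHom ⟨_, hxc⟩ * u + Q.coeffsHom ⟨_, inv_mem hyc⟩ * c :=
      Subtype.ext (Q.x_eq e o)
    change (δ (Q.toPolys (HAlg.x o)) : D) = X
    rw [h1, hadd, hmul, hmul, hcoef, hcoef, zero_mul, zero_mul, zero_add, zero_add, hδu, hδc,
      (haC _).eq, (hbC _).eq]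
    exact Q.ratio_mul_add_bracket_mul e X Y
  · have h1 : Q.toPolys (HAlg.y o) = Q.coeffsHom ⟨_, hyc⟩ * u := Subtype.ext (Q.y_eq e o)
    change (δ (Q.toPolys (HAlg.y o)) : D) = Y
    rw [h1, hmul, hcoef, zero_mul, zero_add, hδu, (haC _).eq]
    exact inv_mul_cancel_right₀ hye Y

end SkewExt

/-! ### Iterated derivations of products of linear factors -/

section Leibniz

variable {R : Type*} [Ring R] [Algebra ℂ R] {Δ : R →ₗ[ℂ] R}

theorem polarPow_eq (Δ : R →ₗ[ℂ] R) (n : ℕ) (a : R) :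
    polarPow Δ n a = (n.factorial : ℂ)⁻¹ • (Δ ^ n) a := by
  induction n generalizing a with
  | zero => simp [polarPow]
  | succ n ih =>
    rw [polarPow, ih, map_smul, smul_smul, pow_succ, Module.End.mul_apply, Nat.factorial_succ]
    push_cast
    rw [mul_inv, mul_comm]

theorem leibniz_pow_const_mul (hΔ : ∀ a b, Δ (a * b) = Δ a * b + a * Δ b) {C : R} (hC : Δ C = 0)
    (n : ℕ) (p : R) : (Δ ^ n) (C * p) = C * (Δ ^ n) p := by
  induction n with
  | zero => simp
  | succ n ih =>
    rw [pow_succ', Module.End.mul_apply, ih, hΔ, hC, zero_mul, zero_add, Module.End.mul_apply]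

theorem leibniz_pow_mul_const (hΔ : ∀ a b, Δ (a * b) = Δ a * b + a * Δ b) {C : R} (hC : Δ C = 0)
    (n : ℕ) (p : R) : (Δ ^ n) (p * C) = (Δ ^ n) p * C := by
  induction n with
  | zero => simp
  | succ n ih =>
    rw [pow_succ', Module.End.mul_apply, ih, hΔ, hC, mul_zero, add_zero, Module.End.mul_apply]

/-- The noncommutative Leibniz formula for Δ^{m+1}(a b), cut off after two terms because Δ² a = 0.
-/
theorem leibniz_pow_linear_mul (hΔ : ∀ a b, Δ (a * b) = Δ a * b + a * Δ b) {a : R}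
    (ha : Δ (Δ a) = 0) (m : ℕ) (b : R) : (Δ ^ (m + 1)) (a * b) =
      a * (Δ ^ (m + 1)) b + ((m : ℂ) + 1) • (Δ a * (Δ ^ m) b) := by
  induction m with
  | zero => simp [hΔ, add_comm]
  | succ m ih =>
    have h1 : Δ ((Δ ^ m) b) = (Δ ^ (m + 1)) b := by rw [pow_succ', Module.End.mul_apply]
    rw [pow_succ', Module.End.mul_apply, ih, map_add, map_smul, hΔ, hΔ, ha, zero_mul, zero_add,
      Module.End.mul_apply, h1]
    push_cast
    module

/-- To exhaust n linear factors with n derivations, each factor must be hit exactly once, in n!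
orders. The vanishing of the next power is carried along since the induction needs it. -/
theorem leibniz_pow_list_prod (hΔ : ∀ a b, Δ (a * b) = Δ a * b + a * Δ b) (l : List R)
    (hl : ∀ v ∈ l, Δ (Δ v) = 0) :
    (Δ ^ l.length) l.prod = (l.length.factorial : ℂ) • (l.map Δ).prod ∧
      (Δ ^ (l.length + 1)) l.prod = 0 := by
  induction l with
  | nil =>
    have h1 : Δ 1 = 0 := by simpa using hΔ 1 1
    simp [h1]
  | cons a l ih =>
    obtain ⟨h1, h2⟩ := ih fun v hv => hl v (List.mem_cons_of_mem _ hv)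
    have ha := hl a List.mem_cons_self
    rw [List.length_cons, List.prod_cons, leibniz_pow_linear_mul hΔ ha,
      leibniz_pow_linear_mul hΔ ha, h1, h2, pow_succ' Δ (l.length + 1), Module.End.mul_apply, h2]
    refine ⟨?_, by simp⟩
    rw [mul_zero, zero_add, List.map_cons, List.prod_cons, mul_smul_comm, smul_smul,
      Nat.factorial_succ]
    push_cast
    rfl

theorem polarPow_list_prod (hΔ : ∀ a b, Δ (a * b) = Δ a * b + a * Δ b) (l : List R)
    (hl : ∀ v ∈ l, Δ (Δ v) = 0) : polarPow Δ l.length l.prod = (l.map Δ).prod := by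
  rw [polarPow_eq, (leibniz_pow_list_prod hΔ l hl).1, smul_smul, inv_mul_cancel₀, one_smul]
  exact_mod_cast Nat.factorial_ne_zero _

theorem polarPow_const_mul (hΔ : ∀ a b, Δ (a * b) = Δ a * b + a * Δ b) {C : R} (hC : Δ C = 0)
    (n : ℕ) (p : R) : polarPow Δ n (C * p) = C * polarPow Δ n p := by
  rw [polarPow_eq, polarPow_eq, leibniz_pow_const_mul hΔ hC, mul_smul_comm]

theorem polarPow_mul_const (hΔ : ∀ a b, Δ (a * b) = Δ a * b + a * Δ b) {C : R} (hC : Δ C = 0)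
    (n : ℕ) (p : R) : polarPow Δ n (p * C) = polarPow Δ n p * C := by
  rw [polarPow_eq, polarPow_eq, leibniz_pow_mul_const hΔ hC, smul_mul_assoc]

end Leibniz

/-! ### The full polar of a form -/

namespace HAlg

variable {h : ℂ} {I : Type*} [LinearOrder I]

theorem opPol_x (k l i : I) : opPol k l (x i : HAlg h I) = if i = k then x l else 0 :=
  upperRight_x ..

theorem opPol_y (k l i : I) : opPol k l (y i : HAlg h I) = if i = k then y l else 0 :=
  upperRight_y ..

theorem opPol_eq_zero {k l : I} {a : HAlg h I} (ha : a ∈ sub h ({k}ᶜ : Set I)) :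
    opPol k l a = 0 := by
  have h1 : opPol k l (1 : HAlg h I) = 0 := by simpa using opPol_mul k l (1 : HAlg h I) 1
  induction ha using Algebra.adjoin_induction with
  | mem a ha =>
    rcases ha with ⟨j, hj, rfl⟩ | ⟨j, hj, rfl⟩
    · rw [opPol_x, if_neg (show j ≠ k from hj)]
    · rw [opPol_y, if_neg (show j ≠ k from hj)]
  | algebraMap c => simp [Algebra.algebraMap_eq_smul_one, h1]
  | add a b _ _ ha hb => simp [ha, hb]
  | mul a b _ _ ha hb => simp [opPol_mul, ha, hb]

/-- The full polarization of a form does not contain the variables of the form. -/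
theorem polarPow_formSum_mem {o e : I} (hoe : o ≠ e) {n : ℕ} {A : ℕ → HAlg h I}
    (hA : ∀ k ≤ n, A k ∈ sub h ({o}ᶜ : Set I)) :
    polarPow (opPol o e) n (formSum o n A) ∈ sub h ({o}ᶜ : Set I) := by
  have hterm : ∀ k ≤ n, polarPow (opPol o e) n (x o ^ (n - k) * y o ^ k * A k) =
      x e ^ (n - k) * y e ^ k * A k := by
    intro k hk
    rw [polarPow_mul_const (opPol_mul o e) (opPol_eq_zero (hA k hk))]
    -- The monomial is read as a product of n factors x_o or y_o, so the full polar replaces each by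
    -- x_e or y_e.
    have h1 := polarPow_list_prod (opPol_mul (h := h) o e)
      (List.replicate (n - k) (x o) ++ List.replicate k (y o)) ?_
    · simp only [List.length_append, List.length_replicate, Nat.sub_add_cancel hk,
        List.prod_append, List.prod_replicate, List.map_append, List.map_replicate, opPol_x,
        opPol_y, if_true] at h1
      rw [h1]
    · intro v hv
      rcases List.mem_append.1 hv with hv | hv
      · rw [List.eq_of_mem_replicate hv, opPol_x, if_pos rfl, opPol_x, if_neg hoe.symm]
      · rw [List.eq_of_mem_replicate hv, opPol_y, if_pos rfl, opPol_y, if_neg hoe.symm]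
  have hsum : polarPow (opPol o e) n (formSum o n A) = ∑ k ∈ Finset.range (n + 1),
      (n.choose k : ℂ) • (x e ^ (n - k) * y e ^ k * A k) := by
    rw [formSum, polarPow_eq, map_sum, Finset.smul_sum]
    refine Finset.sum_congr rfl fun k hk => ?_
    rw [map_smul, smul_comm, ← polarPow_eq, hterm k (Nat.lt_succ_iff.1 (Finset.mem_range.1 hk))]
  rw [hsum]
  refine sum_mem fun k hk => Subalgebra.smul_mem _ (mul_mem (mul_mem (pow_mem (x_mem_sub ?_) _)
    (pow_mem (y_mem_sub ?_) _)) (hA k (Nat.lt_succ_iff.1 (Finset.mem_range.1 hk)))) _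
  · exact hoe.symm
  · exact hoe.symm

end HAlg

/-! ### Polars of decomposable forms and zero brackets -/

namespace SkewExt

variable {h : ℂ} {I : Type*} [LinearOrder I] {o : I} {D : Type*} [DivisionRing D] [Algebra ℂ D]
  {Q : SkewExt (h := h) o D} {e : I}

/-- A linear form as a polynomial. -/
noncomputable def linPoly (Q : SkewExt (h := h) o D) (X Y : Q.coeffs) : Q.polys :=
  Q.toPolys (HAlg.x o) * Q.coeffsHom Y - Q.toPolys (HAlg.y o) * Q.coeffsHom X
    - h • (Q.toPolys (HAlg.y o) * Q.coeffsHom Y)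

theorem IsPolarization.linPoly {X' Y' : D} {Δ : Q.polys →ₗ[ℂ] Q.polys}
    (hΔ : Q.IsPolarization X' Y' Δ) (X Y : Q.coeffs) :
    (Δ (Q.linPoly X Y) : D) = X' * Y - Y' * X - h • (Y' * Y) := by
  obtain ⟨h1, h2, h3, h4⟩ := hΔ
  have h5 : ∀ l : Q.coeffs, Δ (Q.coeffsHom l) = 0 := fun l => h4 _ l.2
  simp only [SkewExt.linPoly, map_sub, map_smul, h1, h5, mul_zero, add_zero]
  rw [← h2, ← h3]
  rfl

/-- The polarization of a decomposable form. -/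
theorem polarPow_decomposition (hoe : o ≠ e) {n : ℕ} {f : HAlg h I} (hf : HAlg.IsForm o n f)
    {X Y : Fin n → D} (hdec : Q.IsDecomposition e n f X Y) {X' Y' : D} (hX' : X' ∈ Q.coeffs)
    (hY' : Y' ∈ Q.coeffs) {Δ : Q.polys →ₗ[ℂ] Q.polys} (hΔ : Q.IsPolarization X' Y' Δ) :
    ((polarPow Δ n (Q.toPolys f) : Q.polys) : D) = Q.ι (polarPow (opPol o e) n f) ^ (1 - (n : ℤ)) *
      (List.ofFn fun i => X' * Y i - Y' * X i - h • (Y' * Y i)).prod := by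
  obtain ⟨hlin, -, hprod⟩ := hdec
  obtain ⟨-, -, A, hA, hfA⟩ := hf
  -- The full polar f₁ involves no x_o, y_o, so its power C is a coefficient and a constant for Δ.
  have hC : Q.ι (polarPow (opPol o e) n f) ^ (1 - (n : ℤ)) ∈ Q.coeffs := by
    refine zpow_mem (Q.ι_mem_coeffs ?_) _
    rw [hfA]
    exact HAlg.polarPow_formSum_mem hoe hA
  set C := Q.ι (polarPow (opPol o e) n f) ^ (1 - (n : ℤ))
  let X₀ : Fin n → Q.coeffs := fun i => ⟨X i, (hlin i).1⟩
  let Y₀ : Fin n → Q.coeffs := fun i => ⟨Y i, (hlin i).2.1⟩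
  have hΔl := fun i => hΔ.linPoly (X₀ i) (Y₀ i)
  have h0 : ∀ a : Q.polys, (a : D) ∈ Q.coeffs → Δ a = 0 := hΔ.2.2.2
  have hf' : Q.toPolys f = Q.coeffsHom ⟨C, hC⟩ *
      (List.ofFn fun i => Q.linPoly (X₀ i) (Y₀ i)).prod := by
    apply Subtype.ext
    rw [Subalgebra.coe_mul, SubmonoidClass.coe_list_prod, List.map_ofFn]
    exact hprod
  -- Δ maps a linear form to its bracket with (X', Y'), a coefficient, so Δ² kills it.
  have hlen := polarPow_list_prod hΔ.1 (List.ofFn fun i => Q.linPoly (X₀ i) (Y₀ i)) (by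
    intro v hv
    obtain ⟨i, rfl⟩ := (List.mem_ofFn' _ _).1 hv
    refine h0 _ ?_
    rw [hΔl]
    exact sub_mem (sub_mem (mul_mem hX' (Y₀ i).2) (mul_mem hY' (X₀ i).2))
      (Q.smul_mem_coeffs h (mul_mem hY' (Y₀ i).2)))
  rw [List.length_ofFn] at hlen
  rw [hf', polarPow_const_mul hΔ.1 (h0 (Q.coeffsHom ⟨C, hC⟩) hC), hlen, Subalgebra.coe_mul,
    SubmonoidClass.coe_list_prod, List.map_ofFn, List.map_ofFn]
  congr 2
  exact congrArg List.ofFn (funext hΔl)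

/-- Linear forms with proportional coordinates are the ones which are annihilated by the
polarization. -/
theorem mul_inv_eq_of_bracket_eq_zero (hh : h ≠ 0) (hoe : o ≠ e) {X Y X' Y' : D}
    (hL : Q.IsLinearForm X Y) (hL' : Q.IsLinearForm X' Y')
    (h0 : X' * Y - Y' * X - h • (Y' * Y) = 0) : X * Y⁻¹ = X' * Y'⁻¹ := by
  have hP := hL.pointOn hh hoe
  have hP' := hL'.pointOn hh hoe
  have hY := hL.ne_zero hh hoe
  have hY' := hL'.ne_zero hh hoe
  have kX := (hL.K_eq hh hoe).2
  have kY' : Q.K.symm Y' = Y' := by rw [AlgEquiv.symm_apply_eq, (hL'.K_eq hh hoe).1]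
  -- Since Y' K(X) = X Y' and K X = X + h Y, the bracket is simply X' Y - X Y'.
  have h1 : X' * Y = X * Y' := by
    have h2 := hP'.y_mul _ (K_mem_coeffs hoe hL.1)
    rw [AlgEquiv.symm_apply_apply, kX, mul_add, mul_smul_comm] at h2
    rw [← h2, ← sub_eq_zero, ← h0]
    abel
  have h3 : Y * Y' = Y' * Y := by rw [hP.y_mul _ hL'.2.1, kY']
  have h4 : X' = X * Y⁻¹ * Y' := by
    apply mul_right_cancel₀ hY
    rw [h1, mul_assoc (X * Y⁻¹), ← h3, ← mul_assoc, inv_mul_cancel_right₀ hY]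
  rw [h4, mul_inv_cancel_right₀ hY']

/-- The pair (X, Y) is a point relative to its own coordinate: `x_mul` at l = Y, with K Y = Y and
Hsym Y = -Y, reads X Y = Y X + h Y². -/
theorem bracket_self (hh : h ≠ 0) (hoe : o ≠ e) {X Y : D} (hL : Q.IsLinearForm X Y) :
    X * Y - Y * X - h • (Y * Y) = 0 := by
  have h1 := (hL.pointOn hh hoe).x_mul _ hL.2.1
  rw [(hL.K_eq hh hoe).1, (hL.Hsym_eq hh hoe).1, mul_neg, smul_neg] at h1
  rw [h1]
  abel

end SkewExt

theorem proposition15 {I : Type*} [LinearOrder I] (o e : I) (hoe : o ≠ e) (h : ℂ) (hh : h ≠ 0)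
    {D : Type*} [DivisionRing D] [Algebra ℂ D] (Q : SkewExt (h := h) o D)
    (n : ℕ) (f : HAlg h I) (hf : HAlg.IsForm o n f)
    (A : ℕ → HAlg h I) (hA : ∀ k ≤ n, A k ∈ HAlg.sub h {o, e}ᶜ) (hfA : f = HAlg.formSum o n A)
    (X Y : Fin n → D) (hdec : Q.IsDecomposition e n f X Y) :
    -- projective coordinates and polarization operators of linear forms are well defined
    (∀ X' Y' : D, Q.IsLinearForm X' Y' → Y' ≠ 0 ∧ ∃! Δ, Q.IsPolarization X' Y' Δ) ∧
    -- (i)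
    (∀ i, ∀ Δ, Q.IsPolarization (X i) (Y i) Δ → polarPow Δ n (Q.toPolys f) = 0) ∧
    -- (ii)
    (∀ X' Y' : D, Q.IsLinearForm X' Y' →
      ∀ Δ, Q.IsPolarization X' Y' Δ → polarPow Δ n (Q.toPolys f) = 0 →
      ∃ i, X i * (Y i)⁻¹ + algebraMap ℂ D (h / 2) = X' * Y'⁻¹ + algebraMap ℂ D (h / 2)) := by
  have hlin := hdec.1
  refine ⟨fun X' Y' hL => ⟨hL.ne_zero hh hoe, ?_⟩, fun i Δ hΔ => ?_, fun X' Y' hL Δ hΔ h0 => ?_⟩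
  · obtain ⟨Δ, hΔ⟩ := SkewExt.exists_polarization hh hoe hL.1 hL.2.1 (hL.pointOn hh hoe)
    exact ⟨Δ, hΔ, fun Δ' hΔ' => hΔ'.unique hΔ⟩
  · apply Subtype.ext
    rw [SkewExt.polarPow_decomposition hoe hf hdec (hlin i).1 (hlin i).2.1 hΔ,
      List.prod_eq_zero, mul_zero, ZeroMemClass.coe_zero]
    rw [← SkewExt.bracket_self hh hoe (hlin i)]
    exact (List.mem_ofFn' _ _).2 ⟨i, rfl⟩
  · have h1 := SkewExt.polarPow_decomposition hoe hf hdec hL.1 hL.2.1 hΔ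
    rw [h0, ZeroMemClass.coe_zero, eq_comm, mul_eq_zero] at h1
    -- C cannot vanish, for otherwise the decomposition would give f = 0.
    have hC : Q.ι (polarPow (HAlg.opPol o e) n f) ^ (1 - (n : ℤ)) ≠ 0 := by
      intro hC
      have h2 := hdec.2.2
      rw [hC, zero_mul, map_eq_zero_iff _ Q.ι_injective] at h2
      exact hf.1 h2
    obtain ⟨i, hi⟩ := (List.mem_ofFn' _ _).1 (List.prod_eq_zero_iff.1 (h1.resolve_left hC))
    exact ⟨i, by rw [SkewExt.mul_inv_eq_of_bracket_eq_zero hh hoe (hlin i) hL hi]⟩
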